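/- All Banach spaces are real. A short exact sequence $0\to Y\to E\to X\to 0$ consists of Banach spaces and bounded operators, the kernel of each arrow being the image of the preceding one; it is trivial (splits) if there is a bounded operator $T:E\to Y\oplus X$ that forms with the identities of $Y$ and $X$ a commutative diagram from it to $0\to Y\to Y\oplus X\to X\to 0$. For Banach spaces $X,Y$ let $\mathrm{Ext}^2(X,Y)$ be the set of concatenations $FG$ of short exact sequences $F:\ 0\to Y\to A\to B\to 0$ and $G:\ 0\to B\to C\to X\to 0$, modulo the equivalence relation generated by: $FG\sim F'G'$ if there are bounded operators $A\to A'$, $B\to B'$, $C\to C'$ that form with the identities of $Y$ and $X$ a commutative diagram from $0\to Y\to A\to B\to C\to X\to 0$ to $0\to Y\to A'\to B'\to C'\to X\to 0$. An element of $\mathrm{Ext}^2(X,Y)$ is $0$ if it has a representative $FG$ for which there are a Banach space $D$ and short exact sequences $0\to A\to D\to X\to 0$ and $0\to Y\to D\to C\to 0$ such that $Y\to D$ is the composition $Y\to A\to D$, the compositions $A\to D\to C$ and $A\to B\to C$ agree, and $D\to X$ is the composition $D\to C\to X$. We write $\mathrm{Ext}^2(X,Y)=0$ if all its elements are $0$.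 **Proposition.** There is a Banach space $Z$ with $\mathrm{Ext}^2(Z,\ell_2)\neq 0$, and there is a Banach space $K$ with $\mathrm{Ext}^2(\ell_2,K)\neq 0$. More precisely, there exist a nontrivial short exact sequence $0\to\ell_2\to X\to\ell_2\to 0$, a short exact sequence $0\to\ell_2\to L_1(0,1)\to Z\to 0$, and a short exact sequence $0\to K\to\ell_\infty\to\ell_2\to 0$; and for every choice of three such sequences, 1. the concatenation $0\to\ell_2\to X\to\ell_2\to L_1(0,1)\to Z\to 0$ is a nonzero element of $\mathrm{Ext}^2(Z,\ell_2)$; 2. the concatenation $0\to K\to\ell_\infty\to\ell_2\to X\to\ell_2\to 0$ is a nonzero element of $\mathrm{Ext}^2(\ell_2,K)$. -/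

import Mathlib

universe u

namespace BanachExt

section Sequences

variable {X Y E : Type u}
  [NormedAddCommGroup X] [NormedSpace ℝ X] [CompleteSpace X]
  [NormedAddCommGroup Y] [NormedSpace ℝ Y] [CompleteSpace Y]
  [NormedAddCommGroup E] [NormedSpace ℝ E] [CompleteSpace E]

/-- `0 → Y → E → X → 0` (with maps `i`, `q`) is a short exact sequence of Banach spaces. -/
structure IsShortExact (i : Y →L[ℝ] E) (q : E →L[ℝ] X) : Prop where
  injective : Function.Injective i
  exact : Function.Exact i q
  surjective : Function.Surjective q

end Sequences

/-- A short exact sequence `0 → Y → E → X → 0` of real Banach spaces (a twisted sum of `Y`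
and `X`); a representative of an element of `Ext(X, Y)`. -/
structure Extension (X Y : Type u)
    [NormedAddCommGroup X] [NormedSpace ℝ X] [CompleteSpace X]
    [NormedAddCommGroup Y] [NormedSpace ℝ Y] [CompleteSpace Y] where
  space : Type u
  [normed : NormedAddCommGroup space]
  [normedSpace : NormedSpace ℝ space]
  [complete : CompleteSpace space]
  i : Y →L[ℝ] space
  q : space →L[ℝ] X
  isShortExact : IsShortExact i q

attribute [instance] Extension.normed Extension.normedSpace Extension.complete

namespace Extension

variable {X Y : Type u}
  [NormedAddCommGroup X] [NormedSpace ℝ X] [CompleteSpace X]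
  [NormedAddCommGroup Y] [NormedSpace ℝ Y] [CompleteSpace Y]

/-- Equivalence of extensions: an operator `T` between the middle spaces which is compatible with
the identities of `Y` and `X`. -/
def Equivalent (F F' : Extension X Y) : Prop :=
  ∃ T : F.space →L[ℝ] F'.space, T.comp F.i = F'.i ∧ F'.q.comp T = F.q

/-- The trivial sequence `0 → Y → Y ⊕ X → X → 0`. -/
noncomputable def trivial (X Y : Type u)
    [NormedAddCommGroup X] [NormedSpace ℝ X] [CompleteSpace X]
    [NormedAddCommGroup Y] [NormedSpace ℝ Y] [CompleteSpace Y] : Extension X Y where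
  space := Y × X
  i := ContinuousLinearMap.inl ℝ Y X
  q := ContinuousLinearMap.snd ℝ Y X
  isShortExact :=
    { injective := fun _ _ h => congrArg Prod.fst h
      exact := fun z => ⟨fun h => ⟨z.1, Prod.ext rfl h.symm⟩, fun ⟨_, h⟩ => h ▸ rfl⟩
      surjective := fun x => ⟨(0, x), rfl⟩ }

def Splits (F : Extension X Y) : Prop := F.Equivalent (trivial X Y)

end Extension

/-- A concatenation `FG` of `G : 0 → B → C → X → 0` and `F : 0 → Y → A → B → 0`, that is,
an exact sequence `0 → Y → A → C → X → 0` factored through `B`. -/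
structure Concatenation (X Y : Type u)
    [NormedAddCommGroup X] [NormedSpace ℝ X] [CompleteSpace X]
    [NormedAddCommGroup Y] [NormedSpace ℝ Y] [CompleteSpace Y] where
  mid : Type u
  [normed : NormedAddCommGroup mid]
  [normedSpace : NormedSpace ℝ mid]
  [complete : CompleteSpace mid]
  F : Extension mid Y
  G : Extension X mid

attribute [instance] Concatenation.normed Concatenation.normedSpace Concatenation.complete

namespace Concatenation

variable {X Y : Type u}
  [NormedAddCommGroup X] [NormedSpace ℝ X] [CompleteSpace X]
  [NormedAddCommGroup Y] [NormedSpace ℝ Y] [CompleteSpace Y]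

/-- `FG ⟶ F'G'`: a commutative diagram of operators from the first sequence to the second one
which is the identity on `Y` and on `X`. -/
def Arrow (S S' : Concatenation X Y) : Prop :=
  ∃ (a : S.F.space →L[ℝ] S'.F.space) (b : S.mid →L[ℝ] S'.mid)
    (c : S.G.space →L[ℝ] S'.G.space),
    a.comp S.F.i = S'.F.i ∧
    S'.F.q.comp a = b.comp S.F.q ∧
    c.comp S.G.i = S'.G.i.comp b ∧
    S'.G.q.comp c = S.G.q

/-- For `F : 0 → Y → A → B → 0` and `G : 0 → B → C → X → 0`, the diagram exhibiting `FG` as zero: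
a Banach space `D` with exact sequences `0 → A → D → X → 0` and `0 → Y → D → C → 0` which
form with `F` (column), `G` (row) and the identities of `Y` and `X` a commutative diagram. -/
def HasZeroDiagram (S : Concatenation X Y) : Prop :=
  ∃ (D : Type u) (_ : NormedAddCommGroup D) (_ : NormedSpace ℝ D) (_ : CompleteSpace D)
    (s : S.F.space →L[ℝ] D) (t : D →L[ℝ] X) (k : Y →L[ℝ] D) (v : D →L[ℝ] S.G.space),
    IsShortExact s t ∧ IsShortExact k v ∧
    s.comp S.F.i = k ∧
    v.comp s = S.G.i.comp S.F.q ∧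
    S.G.q.comp v = t

end Concatenation

/-- `Ext²(X, Y)`: concatenations modulo the equivalence relation generated by `Arrow`
(finite zigzags of arrows). -/
def Ext2 (X Y : Type u)
    [NormedAddCommGroup X] [NormedSpace ℝ X] [CompleteSpace X]
    [NormedAddCommGroup Y] [NormedSpace ℝ Y] [CompleteSpace Y] : Type (u + 1) :=
  Quot (Concatenation.Arrow (X := X) (Y := Y))

namespace Ext2

variable {X Y B : Type u}
  [NormedAddCommGroup X] [NormedSpace ℝ X] [CompleteSpace X]
  [NormedAddCommGroup Y] [NormedSpace ℝ Y] [CompleteSpace Y]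
  [NormedAddCommGroup B] [NormedSpace ℝ B] [CompleteSpace B]

/-- The element of `Ext²(X, Y)` given by the concatenation `FG`. -/
def mk (F : Extension B Y) (G : Extension X B) : Ext2 X Y :=
  Quot.mk _ { mid := B, F := F, G := G }

/-- An element of `Ext²(X, Y)` is `0` if it is represented by a concatenation that admits the
zero diagram. In particular an element that is not zero has no representative at all with such
a diagram. -/
def IsZero (e : Ext2 X Y) : Prop :=
  ∃ S : Concatenation X Y, S.HasZeroDiagram ∧ Quot.mk _ S = e

/-- `Ext²(X, Y) = 0`. -/
def Vanishes (X Y : Type u)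
    [NormedAddCommGroup X] [NormedSpace ℝ X] [CompleteSpace X]
    [NormedAddCommGroup Y] [NormedSpace ℝ Y] [CompleteSpace Y] : Prop :=
  ∀ e : Ext2 X Y, e.IsZero

end Ext2

/-- Real `ℓ₂`. -/
abbrev ell2 : Type := lp (fun _ : ℕ => ℝ) 2

/-- Real `ℓ_∞`. -/
abbrev ellInfty : Type := lp (fun _ : ℕ => ℝ) ⊤

/-- Real `L₁(0,1)`. -/
abbrev L1 : Type :=
  MeasureTheory.Lp ℝ 1 (MeasureTheory.volume.restrict (Set.Ioo (0 : ℝ) 1))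

end BanachExt

/-! Write F for 0 → Y → A → B → 0 and G for 0 → B → C → X → 0. A zero diagram for FG contains a
space D that is both an extension of C by Y and an extension of X by A. If every extension of C by Y
splits, a bounded section of D → C carries B into A and so splits F (`IsZero.splits_left`). If every
extension of X by A splits, a section of D → X followed by D → C splits G (`IsZero.splits_right`).
An arrow of concatenations transports zero diagrams in both directions, by pullback and by pushout,
so being zero can be tested on the given representative (`isZero_mk_iff`). Two vanishing results
then suffice: extensions by `ℓ_∞` split by Hahn–Banach in each coordinate (`splits_of_ellInfty`),
and extensions of L₁(0,1) by ℓ₂ split (`splits_of_L1`). For the latter, averaging operators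
factoring through finite-dimensional ℓ₁ lift with a uniform bound; the resulting almost-retractions
onto ℓ₂ have a coordinatewise ultralimit.

The building blocks come from finite averages over signs. The Kalton–Peck space is a nontrivial
twisted sum of ℓ₂ with itself: a section, tested on all sign vectors of length n, would bound log n.
Riesz products, bounded in terms of the ℓ₂ norm only and with prescribed sign coefficients, give
both Khintchine's lower inequality, hence ℓ₂ ⊂ L₁ through Rademacher functions, and a surjection
`ℓ_∞` → ℓ₂. -/

namespace BanachExt

/-! ### Short exact sequences, sections and retractions -/

section ShortExact

variable {X Y E : Type u}
  [NormedAddCommGroup X] [NormedSpace ℝ X] [NormedAddCommGroup Y] [NormedSpace ℝ Y]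
  [NormedAddCommGroup E] [NormedSpace ℝ E]
  {i : Y →L[ℝ] E} {q : E →L[ℝ] X}

namespace IsShortExact

theorem apply_apply (h : IsShortExact i q) (y : Y) : q (i y) = 0 :=
  (h.exact _).2 ⟨y, rfl⟩

theorem exists_of_eq_zero (h : IsShortExact i q) {e : E} (he : q e = 0) : ∃ y, i y = e :=
  (h.exact e).1 he

theorem isClosed_range (h : IsShortExact i q) : IsClosed (Set.range i) := by
  have : Set.range i = q ⁻¹' {0} := Set.ext fun e => (h.exact e).symm
  rw [this]
  exact isClosed_singleton.preimage q.continuous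

variable [CompleteSpace Y] [CompleteSpace E]

/-- An operator into the middle space killed by the quotient map factors through the kernel. -/
theorem exists_lift (h : IsShortExact i q) {W : Type*} [NormedAddCommGroup W] [NormedSpace ℝ W]
    (f : W →L[ℝ] E) (hf : ∀ w, q (f w) = 0) : ∃ g : W →L[ℝ] Y, ∀ w, i (g w) = f w := by
  let e := i.equivRange h.injective h.isClosed_range
  refine ⟨e.symm.toContinuousLinearMap.comp
    (f.codRestrict i.range fun w => h.exists_of_eq_zero (hf w)), fun w => ?_⟩
  have := e.apply_symm_apply
    (f.codRestrict i.range (fun w => h.exists_of_eq_zero (hf w)) w)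
  exact congrArg Subtype.val this

/-- The operator (r, q) : E → Y × X is bijective, hence an isomorphism by the open mapping theorem;
its inverse restricted to X is the section. -/
theorem exists_section_of_retraction [CompleteSpace X] (h : IsShortExact i q)
    (r : E →L[ℝ] Y)
    (hr : ∀ y, r (i y) = y) : ∃ s : X →L[ℝ] E, ∀ x, q (s x) = x := by
  let T : E →L[ℝ] Y × X := r.prod q
  have hinj : Function.Injective T := by
    rw [injective_iff_map_eq_zero]
    intro e he
    obtain ⟨h1, h2⟩ : r e = 0 ∧ q e = 0 := Prod.ext_iff.1 he
    obtain ⟨y, rfl⟩ := h.exists_of_eq_zero h2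
    rw [hr] at h1
    rw [h1, map_zero]
  have hsurj : Function.Surjective T := by
    rintro ⟨y, x⟩
    obtain ⟨e, rfl⟩ := h.surjective x
    refine ⟨e + i (y - r e), Prod.ext ?_ ?_⟩
    · simp [T, hr]
    · simp [T, h.apply_apply]
  let e := ContinuousLinearEquiv.ofBijective T (LinearMap.ker_eq_bot.2 hinj)
    (LinearMap.range_eq_top.2 hsurj)
  refine ⟨e.symm.toContinuousLinearMap.comp (ContinuousLinearMap.inr ℝ Y X), fun x => ?_⟩
  exact congrArg Prod.snd (e.apply_symm_apply (0, x))

theorem exists_retraction_of_section (h : IsShortExact i q) (s : X →L[ℝ] E)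
    (hs : ∀ x, q (s x) = x) : ∃ r : E →L[ℝ] Y, ∀ y, r (i y) = y := by
  obtain ⟨r, hr⟩ := h.exists_lift (ContinuousLinearMap.id ℝ E - s.comp q) fun e => by simp [hs]
  refine ⟨r, fun y => h.injective ?_⟩
  rw [hr]
  simp [h.apply_apply]

end IsShortExact

end ShortExact

namespace Extension

variable {X Y : Type u}
  [NormedAddCommGroup X] [NormedSpace ℝ X] [CompleteSpace X]
  [NormedAddCommGroup Y] [NormedSpace ℝ Y] [CompleteSpace Y]

theorem splits_iff_retraction (F : Extension X Y) :
    F.Splits ↔ ∃ r : F.space →L[ℝ] Y, ∀ y, r (F.i y) = y := by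
  constructor
  · rintro ⟨T, hi, -⟩
    exact ⟨(ContinuousLinearMap.fst ℝ Y X).comp T,
      fun y => congrArg Prod.fst (DFunLike.congr_fun hi y)⟩
  · rintro ⟨r, hr⟩
    refine ⟨r.prod F.q, ?_, ?_⟩
    · refine ContinuousLinearMap.ext fun y => ?_
      exact Prod.ext (hr y) (F.isShortExact.apply_apply y)
    · rfl

theorem splits_iff_section (F : Extension X Y) :
    F.Splits ↔ ∃ s : X →L[ℝ] F.space, ∀ x, F.q (s x) = x := by
  rw [splits_iff_retraction]
  exact ⟨fun ⟨r, hr⟩ => F.isShortExact.exists_section_of_retraction r hr,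
    fun ⟨s, hs⟩ => F.isShortExact.exists_retraction_of_section s hs⟩

end Extension

/-! ### Invariance of zero diagrams under arrows -/

namespace Concatenation

variable {X Y : Type u}
  [NormedAddCommGroup X] [NormedSpace ℝ X] [CompleteSpace X]
  [NormedAddCommGroup Y] [NormedSpace ℝ Y] [CompleteSpace Y]
  {S S' : Concatenation X Y}

/-- Pull back the zero diagram along the operator between the third spaces. -/
theorem Arrow.hasZeroDiagram_source (h : S.Arrow S') (hz : S'.HasZeroDiagram) :
    S.HasZeroDiagram := by
  obtain ⟨a, b, c, ha, hab, hbc, hc⟩ := h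
  obtain ⟨D', _, _, _, s', t', k', v', hst, hkv, hk, hvs, ht⟩ := hz
  replace ha := fun y => DFunLike.congr_fun ha y
  replace hab := fun y => DFunLike.congr_fun hab y
  replace hbc := fun y => DFunLike.congr_fun hbc y
  replace hc := fun y => DFunLike.congr_fun hc y
  replace hk := fun y => DFunLike.congr_fun hk y
  replace hvs := fun y => DFunLike.congr_fun hvs y
  replace ht := fun y => DFunLike.congr_fun ht y
  simp only [ContinuousLinearMap.comp_apply] at ha hab hbc hc hk hvs ht
  -- The new middle space is the pullback of `v'` and `c`, a closed subspace of the product.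
  let φ : D' × S.G.space →L[ℝ] S'.G.space :=
    v'.comp (ContinuousLinearMap.fst ℝ _ _) - c.comp (ContinuousLinearMap.snd ℝ _ _)
  let D : Submodule ℝ (D' × S.G.space) := LinearMap.ker φ.toLinearMap
  have hD : ∀ w : D' × S.G.space, w ∈ D ↔ v' w.1 = c w.2 := fun w => sub_eq_zero
  have hDc : IsClosed (D : Set (D' × S.G.space)) := φ.isClosed_ker
  have : CompleteSpace D := hDc.completeSpace_coe
  let s : S.F.space →L[ℝ] D := ((s'.comp a).prod (S.G.i.comp S.F.q)).codRestrict D fun x => by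
    rw [hD]
    simp [hvs, hab, hbc]
  let v : D →L[ℝ] S.G.space := (ContinuousLinearMap.snd ℝ _ _).comp D.subtypeL
  have hs1 : ∀ x, (s x).1.1 = s' (a x) := fun x => rfl
  have hs2 : ∀ x, (s x).1.2 = S.G.i (S.F.q x) := fun x => rfl
  have hsi1 : ∀ y, (s (S.F.i y)).1.1 = k' y := fun y => by rw [hs1, ha, hk]
  have hsi2 : ∀ y, (s (S.F.i y)).1.2 = 0 := fun y => by
    rw [hs2, S.F.isShortExact.apply_apply, map_zero]
  have hv : ∀ d, v d = d.1.2 := fun d => rfl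
  have hvz : ∀ d, v d = 0 → ∃ y, s (S.F.i y) = d := by
    intro d hd
    have h1 : v' d.1.1 = 0 := by rw [(hD _).1 d.2, ← hv, hd, map_zero]
    obtain ⟨y, hy⟩ := hkv.exists_of_eq_zero h1
    exact ⟨y, Subtype.ext (Prod.ext ((hsi1 y).trans hy) ((hsi2 y).trans hd.symm))⟩
  refine ⟨D, inferInstance, inferInstance, inferInstance, s, S.G.q.comp v, s.comp S.F.i, v,
    ⟨?_, ?_, ?_⟩, ⟨?_, ?_, ?_⟩, rfl, rfl, rfl⟩
  · rw [injective_iff_map_eq_zero]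
    intro x hx
    have h2 : S.G.i (S.F.q x) = 0 := by rw [← hs2, hx]; rfl
    rw [map_eq_zero_iff _ S.G.isShortExact.injective] at h2
    obtain ⟨y, rfl⟩ := S.F.isShortExact.exists_of_eq_zero h2
    have h1 : k' y = 0 := by rw [← hsi1, hx]; rfl
    rw [map_eq_zero_iff _ hkv.injective] at h1
    rw [h1, map_zero]
  · intro d
    constructor
    · intro hd
      obtain ⟨β, hβ⟩ := S.G.isShortExact.exists_of_eq_zero (e := v d) hd
      obtain ⟨x, rfl⟩ := S.F.isShortExact.surjective β
      obtain ⟨y, hy⟩ := hvz (d - s x) (by rw [map_sub, hv (s x), hs2, hβ, sub_self])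
      exact ⟨x + S.F.i y, by rw [map_add, hy, add_sub_cancel]⟩
    · rintro ⟨x, rfl⟩
      exact S.G.isShortExact.apply_apply _
  · intro x
    obtain ⟨z, rfl⟩ := S.G.isShortExact.surjective x
    obtain ⟨d', hd'⟩ := hkv.surjective (c z)
    exact ⟨⟨(d', z), (hD _).2 hd'⟩, rfl⟩
  · rw [injective_iff_map_eq_zero]
    intro y hy
    have h1 : k' y = 0 := by
      rw [← hsi1, ← ContinuousLinearMap.comp_apply s S.F.i, hy]; rfl
    rwa [map_eq_zero_iff _ hkv.injective] at h1
  · intro d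
    constructor
    · exact hvz d
    · rintro ⟨y, rfl⟩
      exact hsi2 y
  · intro z
    obtain ⟨d', hd'⟩ := hkv.surjective (c z)
    exact ⟨⟨(d', z), (hD _).2 hd'⟩, rfl⟩

/-- Push out the zero diagram along the operator between the first spaces. -/
theorem Arrow.hasZeroDiagram_target (h : S.Arrow S') (hz : S.HasZeroDiagram) :
    S'.HasZeroDiagram := by
  obtain ⟨a, b, c, ha, hab, hbc, hc⟩ := h
  obtain ⟨D, _, _, _, s, t, k, v, hst, hkv, hk, hvs, ht⟩ := hz
  replace ha := fun y => DFunLike.congr_fun ha y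
  replace hab := fun y => DFunLike.congr_fun hab y
  replace hbc := fun y => DFunLike.congr_fun hbc y
  replace hc := fun y => DFunLike.congr_fun hc y
  replace hvs := fun y => DFunLike.congr_fun hvs y
  replace ht := fun y => DFunLike.congr_fun ht y
  simp only [ContinuousLinearMap.comp_apply] at ha hab hbc hc hvs ht
  -- The new middle space is the pushout of `a` and `s`: the quotient of the product by all (a x, -s
  -- x).
  let δ : S.F.space →L[ℝ] S'.F.space × D := a.prod (-s)
  let N : Submodule ℝ (S'.F.space × D) := LinearMap.range δ.toLinearMap
  have hN : ∀ w : S'.F.space × D, w ∈ N ↔ ∃ x, a x = w.1 ∧ -s x = w.2 := fun w =>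
    exists_congr fun x => Prod.ext_iff
  -- Completeness of the quotient norm needs this. The second coordinate of `δ` is already bounded
  -- below, because `s` is an isomorphism onto its closed range.
  have hNc : IsClosed (N : Set (S'.F.space × D)) := by
    obtain ⟨K, hK⟩ := ContinuousLinearMap.antilipschitz_of_injective_of_isClosed_range s
      hst.injective hst.isClosed_range
    have hδ : AntilipschitzWith K δ := by
      refine AddMonoidHomClass.antilipschitz_of_bound δ fun x => ?_
      refine (hK.le_mul_norm (map_zero s) x).trans ?_
      gcongr
      rw [← norm_neg (s x)]
      exact norm_snd_le (δ x)
    exact hδ.isClosed_range δ.uniformContinuous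
  let t₀ : S'.F.space × D →L[ℝ] X := t.comp (ContinuousLinearMap.snd ℝ _ _)
  let v₀ : S'.F.space × D →L[ℝ] S'.G.space :=
    (S'.G.i.comp S'.F.q).coprod (c.comp v)
  let t' : ((S'.F.space × D) ⧸ N) →L[ℝ] X := N.liftQL t₀ fun w hw => by
    obtain ⟨x, -, hx⟩ := (hN w).1 hw
    change t w.2 = 0
    rw [← hx, map_neg, hst.apply_apply, neg_zero]
  let v' : ((S'.F.space × D) ⧸ N) →L[ℝ] S'.G.space := N.liftQL v₀ fun w hw => by
    obtain ⟨x, hx1, hx2⟩ := (hN w).1 hw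
    change S'.G.i (S'.F.q w.1) + c (v w.2) = 0
    rw [← hx1, ← hx2, map_neg, map_neg, hvs, hab, hbc, add_neg_cancel]
  let s' : S'.F.space →L[ℝ] ((S'.F.space × D) ⧸ N) :=
    N.mkQL.comp (ContinuousLinearMap.inl ℝ _ _)
  have hmk : ∀ w, ∃ w', N.mkQL w' = w := N.mkQ_surjective
  have hmk0 : ∀ w, N.mkQL w = 0 ↔ w ∈ N := fun w => Submodule.Quotient.mk_eq_zero N
  have ht' : ∀ x d, t' (N.mkQL (x, d)) = t d := fun x d => rfl
  have hv' : ∀ x d, v' (N.mkQL (x, d)) = S'.G.i (S'.F.q x) + c (v d) := fun x d => rfl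
  have hv's : ∀ x, v' (s' x) = S'.G.i (S'.F.q x) := fun x => by
    change v' (N.mkQL (x, 0)) = _
    rw [hv', map_zero, map_zero, add_zero]
  have hqv : ∀ w, S'.G.q (v' w) = t' w := fun w => by
    obtain ⟨⟨x, d⟩, rfl⟩ := hmk w
    rw [hv', ht', map_add, S'.G.isShortExact.apply_apply, hc, ht, zero_add]
  have hs'inj : ∀ x, s' x = 0 → x = 0 := fun x hx => by
    obtain ⟨y, hy1, hy2⟩ := (hN _).1 ((hmk0 (x, 0)).1 hx)
    rw [neg_eq_zero, map_eq_zero_iff _ hst.injective] at hy2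
    rw [hy2, map_zero] at hy1
    exact hy1.symm
  have hker : ∀ w, t' w = 0 → ∃ x, s' x = w := fun w hw => by
    obtain ⟨⟨x, d⟩, rfl⟩ := hmk w
    obtain ⟨y, rfl⟩ := hst.exists_of_eq_zero (e := d) hw
    refine ⟨x + a y, ?_⟩
    rw [← sub_eq_zero]
    change N.mkQL (x + a y, 0) - N.mkQL (x, s y) = 0
    rw [← map_sub, hmk0, hN]
    exact ⟨y, by simp, by simp⟩
  refine ⟨(S'.F.space × D) ⧸ N, inferInstance, inferInstance, inferInstance, s', t',
    s'.comp S'.F.i, v', ⟨?_, ?_, ?_⟩, ⟨?_, ?_, ?_⟩, rfl, ?_, ?_⟩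
  · exact (injective_iff_map_eq_zero _).2 hs'inj
  · refine fun w => ⟨hker w, ?_⟩
    rintro ⟨x, rfl⟩
    rw [← hqv, hv's, S'.G.isShortExact.apply_apply]
  · intro x
    obtain ⟨d, rfl⟩ := hst.surjective x
    exact ⟨N.mkQL (0, d), rfl⟩
  · exact ((injective_iff_map_eq_zero _).2 hs'inj).comp S'.F.isShortExact.injective
  · intro w
    constructor
    · intro hw
      obtain ⟨x, rfl⟩ := hker w (by rw [← hqv, hw, map_zero])
      rw [hv's, map_eq_zero_iff _ S'.G.isShortExact.injective] at hw
      obtain ⟨y, rfl⟩ := S'.F.isShortExact.exists_of_eq_zero hw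
      exact ⟨y, rfl⟩
    · rintro ⟨y, rfl⟩
      rw [ContinuousLinearMap.comp_apply, hv's, S'.F.isShortExact.apply_apply, map_zero]
  · intro z
    obtain ⟨d, hd⟩ := hst.surjective (S'.G.q z)
    obtain ⟨β, hβ⟩ := S'.G.isShortExact.exists_of_eq_zero (e := z - c (v d)) (by
      rw [map_sub, hc, ht, hd, sub_self])
    obtain ⟨x, rfl⟩ := S'.F.isShortExact.surjective β
    exact ⟨N.mkQL (x, d), by rw [hv', hβ, sub_add_cancel]⟩
  · exact ContinuousLinearMap.ext hv's
  · exact ContinuousLinearMap.ext hqv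

theorem hasZeroDiagram_iff_of_eqvGen (h : Relation.EqvGen Arrow S S') :
    S.HasZeroDiagram ↔ S'.HasZeroDiagram := by
  induction h with
  | rel _ _ h => exact ⟨h.hasZeroDiagram_target, h.hasZeroDiagram_source⟩
  | refl _ => exact Iff.rfl
  | symm _ _ _ ih => exact ih.symm
  | trans _ _ _ _ _ ih₁ ih₂ => exact ih₁.trans ih₂

end Concatenation

/-! ### Vanishing products force a factor to split -/

namespace Ext2

variable {X Y B : Type u}
  [NormedAddCommGroup X] [NormedSpace ℝ X] [CompleteSpace X]
  [NormedAddCommGroup Y] [NormedSpace ℝ Y] [CompleteSpace Y]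
  [NormedAddCommGroup B] [NormedSpace ℝ B] [CompleteSpace B]

theorem isZero_mk_iff (F : Extension B Y) (G : Extension X B) :
    (mk F G).IsZero ↔ (Concatenation.mk B F G).HasZeroDiagram := by
  constructor
  · rintro ⟨S, hS, h⟩
    exact (Concatenation.hasZeroDiagram_iff_of_eqvGen (Quot.eqvGen_exact h)).1 hS
  · exact fun h => ⟨_, h, rfl⟩

/-- If every extension of the third space `C` by `Y` splits, a vanishing product `FG` forces `F`
to split. -/
theorem IsZero.splits_left {F : Extension B Y} {G : Extension X B} (h : (mk F G).IsZero)
    (hC : ∀ H : Extension G.space Y, H.Splits) : F.Splits := by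
  obtain ⟨D, _, _, _, s, t, k, v, hst, hkv, hk, hvs, ht⟩ := (isZero_mk_iff F G).1 h
  replace hvs := fun y => DFunLike.congr_fun hvs y
  replace ht := fun y => DFunLike.congr_fun ht y
  simp only [ContinuousLinearMap.comp_apply] at hvs ht
  obtain ⟨σ, hσ⟩ := (Extension.splits_iff_section ⟨D, k, v, hkv⟩).1 (hC _)
  -- D → X factors through C → X, so the section `σ` sends B into the kernel of D → X, which is A.
  obtain ⟨g, hg⟩ := hst.exists_lift (σ.comp G.i) fun β => by
    rw [← ht, ContinuousLinearMap.comp_apply, hσ, G.isShortExact.apply_apply]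
  refine F.splits_iff_section.2 ⟨g, fun β => G.isShortExact.injective ?_⟩
  rw [← hvs, hg, ContinuousLinearMap.comp_apply, hσ]

/-- If every extension of `X` by the second space `A` splits, a vanishing product `FG` forces `G`
to split. -/
theorem IsZero.splits_right {F : Extension B Y} {G : Extension X B} (h : (mk F G).IsZero)
    (hA : ∀ H : Extension X F.space, H.Splits) : G.Splits := by
  obtain ⟨D, _, _, _, s, t, k, v, hst, hkv, hk, hvs, ht⟩ := (isZero_mk_iff F G).1 h
  replace ht := fun y => DFunLike.congr_fun ht y
  obtain ⟨σ, hσ⟩ := (Extension.splits_iff_section ⟨D, s, t, hst⟩).1 (hA _)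
  exact G.splits_iff_section.2 ⟨v.comp σ, fun x => (ht _).trans (hσ x)⟩

end Ext2

/-! ### Averages over signs, Riesz products and Khintchine's inequality -/

section Signs

open Finset

/-- The sign `±1` attached to a Boolean. -/
def sgn (b : Bool) : ℝ := if b then 1 else -1

theorem sgn_mul_self (b : Bool) : sgn b * sgn b = 1 := by
  cases b <;> simp [sgn]

theorem abs_sgn (b : Bool) : |sgn b| = 1 := by
  cases b <;> simp [sgn]

/-- Average over the `2 ^ n` choices of signs. -/
noncomputable def signAvg (n : ℕ) (f : (Fin n → Bool) → ℝ) : ℝ :=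
  (2 ^ n)⁻¹ * ∑ ε, f ε

variable {n : ℕ}

theorem signAvg_add (f g : (Fin n → Bool) → ℝ) :
    signAvg n (fun ε => f ε + g ε) = signAvg n f + signAvg n g := by
  simp only [signAvg, sum_add_distrib, mul_add]

theorem signAvg_const_mul (c : ℝ) (f : (Fin n → Bool) → ℝ) :
    signAvg n (fun ε => c * f ε) = c * signAvg n f := by
  simp only [signAvg, ← mul_sum]
  ring

theorem signAvg_sum {ι : Type*} (s : Finset ι) (f : ι → (Fin n → Bool) → ℝ) :
    signAvg n (fun ε => ∑ k ∈ s, f k ε) = ∑ k ∈ s, signAvg n (f k) := by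
  simp only [signAvg]
  rw [sum_comm, mul_sum]

theorem signAvg_const (c : ℝ) : signAvg n (fun _ => c) = c := by
  simp [signAvg]

theorem signAvg_mono {f g : (Fin n → Bool) → ℝ} (h : ∀ ε, f ε ≤ g ε) :
    signAvg n f ≤ signAvg n g :=
  mul_le_mul_of_nonneg_left (sum_le_sum fun ε _ => h ε) (by positivity)

theorem abs_signAvg_le {f : (Fin n → Bool) → ℝ} {C : ℝ} (h : ∀ ε, |f ε| ≤ C) :
    |signAvg n f| ≤ C := by
  rw [abs_le]
  constructor
  · rw [← signAvg_const (n := n) (-C)]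
    exact signAvg_mono fun ε => (abs_le.1 (h ε)).1
  · rw [← signAvg_const (n := n) C]
    exact signAvg_mono fun ε => (abs_le.1 (h ε)).2

theorem sum_signs_prod {R : Type*} [CommRing R] (h : Fin n → Bool → R) :
    ∑ ε : Fin n → Bool, ∏ k, h k (ε k) = ∏ k, (h k true + h k false) := by
  rw [← Fintype.piFinset_univ, ← prod_univ_sum]
  simp

theorem signAvg_sgn_mul_sgn (j k : Fin n) :
    signAvg n (fun ε => sgn (ε j) * sgn (ε k)) = if j = k then 1 else 0 := by
  split_ifs with hjk
  · subst hjk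
    simp only [sgn_mul_self, signAvg_const]
  · have h := sum_signs_prod (R := ℝ) (n := n)
      (fun i b => (if i = j then sgn b else 1) * (if i = k then sgn b else 1))
    simp only [prod_mul_distrib, prod_ite_eq', mem_univ, if_true] at h
    rw [signAvg, h, prod_eq_zero (mem_univ j), mul_zero]
    simp [sgn, hjk]

/-- The Riesz product `Im ∏ (1 + i aₖ εₖ)`. -/
noncomputable def rieszProduct (a : Fin n → ℝ) (ε : Fin n → Bool) : ℝ :=
  (∏ k, (1 + (a k * sgn (ε k) : ℝ) * Complex.I)).im

/-- Each factor has modulus √(1 + aₖ²) ≤ exp(aₖ²). The point is that the bound depends only on the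
ℓ₂ norm of the coefficients, not on n. -/
theorem abs_rieszProduct_le (a : Fin n → ℝ) (ε : Fin n → Bool) :
    |rieszProduct a ε| ≤ Real.exp (∑ k, a k ^ 2) := by
  refine (Complex.abs_im_le_norm _).trans ?_
  rw [norm_prod, Real.exp_sum]
  refine prod_le_prod (fun _ _ => norm_nonneg _) fun k _ => ?_
  have h1 : ‖1 + (a k * sgn (ε k) : ℝ) * Complex.I‖ ^ 2 = 1 + a k ^ 2 := by
    rw [Complex.sq_norm, Complex.normSq_apply]
    simp only [Complex.add_re, Complex.one_re, Complex.mul_re, Complex.ofReal_re, Complex.I_re,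
      Complex.ofReal_im, Complex.I_im, Complex.add_im, Complex.one_im, Complex.mul_im]
    linear_combination (a k ^ 2) * sgn_mul_self (ε k)
  have h2 : 1 + a k ^ 2 ≤ Real.exp (a k ^ 2) := by
    linarith [Real.add_one_le_exp (a k ^ 2)]
  nlinarith [sq_nonneg (a k), norm_nonneg (1 + (a k * sgn (ε k) : ℝ) * Complex.I)]

/-- By independence the average of the product factorises: the factor at j averages to i aⱼ once
multiplied by its sign, and every other factor averages to 1. -/
theorem signAvg_rieszProduct_mul_sgn (a : Fin n → ℝ) (j : Fin n) :
    signAvg n (fun ε => rieszProduct a ε * sgn (ε j)) = a j := by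
  have h := sum_signs_prod (R := ℂ) (n := n)
    (fun i b => (1 + (a i * sgn b : ℝ) * Complex.I) * (if i = j then (sgn b : ℂ) else 1))
  have h1 : ∀ k, ((1 + (a k * sgn true : ℝ) * Complex.I) * (if k = j then (sgn true : ℂ) else 1) +
      (1 + (a k * sgn false : ℝ) * Complex.I) * (if k = j then (sgn false : ℂ) else 1)) =
      2 * if k = j then (a j : ℂ) * Complex.I else 1 := by
    intro k
    by_cases hk : k = j
    · subst hk
      simp [sgn]
      ring
    · simp [sgn, hk]
      ring
  simp only [h1, prod_mul_distrib, prod_ite_eq', mem_univ, if_true, prod_const, card_univ,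
    Fintype.card_fin] at h
  have h2 := congrArg Complex.im h
  rw [Complex.im_sum] at h2
  have h3 : ((2 : ℂ) ^ n * (a j * Complex.I)).im = 2 ^ n * a j := by
    rw [show ((2 : ℂ) ^ n) = ((2 ^ n : ℝ) : ℂ) by push_cast; rfl, Complex.im_ofReal_mul]
    simp
  rw [h3] at h2
  simp only [Complex.im_mul_ofReal] at h2
  rw [signAvg]
  simp only [rieszProduct]
  rw [h2]
  field_simp

theorem signAvg_sq_sum (a : Fin n → ℝ) :
    signAvg n (fun ε => (∑ k, a k * sgn (ε k)) ^ 2) = ∑ k, a k ^ 2 := by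
  have h : ∀ ε : Fin n → Bool, (∑ k, a k * sgn (ε k)) ^ 2 =
      ∑ j, ∑ k, (a j * a k) * (sgn (ε j) * sgn (ε k)) := fun ε => by
    rw [sq, sum_mul_sum]
    exact sum_congr rfl fun j _ => sum_congr rfl fun k _ => by ring
  simp only [h, signAvg_sum, signAvg_const_mul, signAvg_sgn_mul_sgn, mul_ite, mul_one, mul_zero,
    sum_ite_eq, mem_univ, if_true]
  exact sum_congr rfl fun j _ => (sq _).symm

/-- Bessel's inequality for the coordinate signs. -/
theorem sum_sq_signAvg_le (f : (Fin n → Bool) → ℝ) :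
    ∑ k, signAvg n (fun ε => f ε * sgn (ε k)) ^ 2 ≤ signAvg n (fun ε => f ε ^ 2) := by
  let c : Fin n → ℝ := fun k => signAvg n (fun ε => f ε * sgn (ε k))
  have h0 : 0 ≤ signAvg n (fun ε => (f ε - ∑ k, c k * sgn (ε k)) ^ 2) := by
    rw [← signAvg_const (n := n) 0]
    exact signAvg_mono fun ε => sq_nonneg _
  have h1 : ∀ ε, (f ε - ∑ k, c k * sgn (ε k)) ^ 2 =
      f ε ^ 2 + ((-2) * ∑ k, c k * (f ε * sgn (ε k)) + (∑ k, c k * sgn (ε k)) ^ 2) := fun ε => by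
    have : ∑ k, c k * (f ε * sgn (ε k)) = f ε * ∑ k, c k * sgn (ε k) := by
      rw [mul_sum]
      exact sum_congr rfl fun k _ => by ring
    rw [this]
    ring
  have h2 : ∑ k, c k * signAvg n (fun ε => f ε * sgn (ε k)) = ∑ k, c k ^ 2 :=
    sum_congr rfl fun k _ => (sq _).symm
  simp only [h1, signAvg_add, signAvg_const_mul, signAvg_sq_sum, signAvg_sum, h2] at h0
  change ∑ k, c k ^ 2 ≤ _
  linarith

/-- The lower Khintchine inequality in `L₁`. -/
theorem sum_sq_le_exp_mul_signAvg (a : Fin n → ℝ) :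
    ∑ k, a k ^ 2 ≤ Real.exp (∑ k, a k ^ 2) * signAvg n (fun ε => |∑ k, a k * sgn (ε k)|) := by
  -- Duality: pairing the sign sum with its own Riesz product recovers the sum of squares.
  have h : ∑ k, a k ^ 2 = signAvg n (fun ε => ∑ k, a k * (rieszProduct a ε * sgn (ε k))) := by
    simp only [signAvg_sum, signAvg_const_mul, signAvg_rieszProduct_mul_sgn, sq]
  rw [← signAvg_const_mul]
  conv_lhs => rw [h]
  refine signAvg_mono fun ε => (le_abs_self _).trans ?_
  have : ∑ k, a k * (rieszProduct a ε * sgn (ε k)) =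
      rieszProduct a ε * ∑ k, a k * sgn (ε k) := by
    rw [mul_sum]
    exact sum_congr rfl fun k _ => by ring
  rw [this, abs_mul]
  gcongr
  exact abs_rieszProduct_le a ε

end Signs

/-! ### Elementary facts on ℓ₂ -/

section Ell2

theorem norm_sq_eq_tsum (x : ell2) : ‖x‖ ^ 2 = ∑' k, x k ^ 2 := by
  have := lp.norm_rpow_eq_tsum (p := 2) (by norm_num) x
  simpa using this

theorem sum_sq_le_norm_sq (x : ell2) (s : Finset ℕ) : ∑ k ∈ s, x k ^ 2 ≤ ‖x‖ ^ 2 := by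
  have := lp.sum_rpow_le_norm_rpow (p := 2) (by norm_num) x s
  simpa using this

theorem abs_apply_le_norm (x : ell2) (k : ℕ) : |x k| ≤ ‖x‖ :=
  lp.norm_apply_le_norm (by norm_num) x k

/-- A sequence whose finite sums of squares are bounded by `C ^ 2` is in `ℓ₂`, of norm at most
`C`. -/
theorem exists_ell2_of_sum_sq_le (y : ℕ → ℝ) {C : ℝ} (hC : 0 ≤ C)
    (h : ∀ s : Finset ℕ, ∑ k ∈ s, y k ^ 2 ≤ C ^ 2) : ∃ x : ell2, (∀ k, x k = y k) ∧ ‖x‖ ≤ C := by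
  have hm : Memℓp (E := fun _ : ℕ => ℝ) y 2 := memℓp_gen' (C := C ^ 2) fun s => by simpa using h s
  refine ⟨⟨y, hm⟩, fun k => rfl, ?_⟩
  refine lp.norm_le_of_forall_sum_le (by norm_num) hC fun s => ?_
  simpa using h s

end Ell2

/-! ### The Kalton–Peck twisted Hilbert space -/

section TwistedHilbert

open Finset

/-- Both ab log(a/b) ≤ a² and its mirror image follow from log t ≤ t - 1. Summed over coordinates,
this says that x ↦ x log |x| is symmetric for the ℓ₂ pairing up to a bounded error; `Real.log`
ignores signs. -/
theorem abs_mul_log_sub_mul_log_le (x z : ℝ) :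
    |x * Real.log x * z - x * (z * Real.log z)| ≤ x ^ 2 + z ^ 2 := by
  rcases eq_or_ne x 0 with rfl | hx
  · simp [sq_nonneg]
  rcases eq_or_ne z 0 with rfl | hz
  · simp [sq_nonneg]
  have hx' := abs_pos.2 hx
  have hz' := abs_pos.2 hz
  have key : ∀ a b : ℝ, 0 < a → 0 < b → a * b * (Real.log a - Real.log b) ≤ a ^ 2 := by
    intro a b ha hb
    rw [← Real.log_div ha.ne' hb.ne']
    have h1 := Real.log_le_sub_one_of_pos (div_pos ha hb)
    calc a * b * Real.log (a / b) ≤ a * b * (a / b - 1) := by gcongr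
      _ = a ^ 2 - a * b := by field_simp
      _ ≤ a ^ 2 := by nlinarith
  have h1 := key _ _ hx' hz'
  have h2 := key _ _ hz' hx'
  rw [Real.log_abs, Real.log_abs, sq_abs] at h1 h2
  have : x * Real.log x * z - x * (z * Real.log z) = x * z * (Real.log x - Real.log z) := by ring
  rw [this, abs_mul, abs_mul]
  rcases abs_cases (Real.log x - Real.log z) with ⟨h, -⟩ | ⟨h, -⟩ <;> rw [h] <;>
    nlinarith [sq_nonneg x, sq_nonneg z]

/-- Finitely supported vectors of the unit ball of `ℓ₂`, given by a finite set of coordinates and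
the values there. -/
def TestVector : Type := {z : Finset ℕ × (ℕ → ℝ) // ∑ k ∈ z.1, z.2 k ^ 2 ≤ 1}

/-- The `k`-th unit vector as a test vector. -/
def TestVector.unit (k : ℕ) : TestVector := ⟨({k}, fun _ => 1), by simp⟩

/-- The functional on the ambient space of the twisted sum whose vanishing, for all `z`, says that
`g z = ⟨y, z⟩ - ⟨x, z log |z|⟩` for the sequence `y` of values of `g` on the unit vectors. -/
noncomputable def twistedRelation (z : TestVector) :
    lp (fun _ : TestVector => ℝ) ⊤ × ell2 →L[ℝ] ℝ :=
  (lp.evalCLM ℝ _ ⊤ z).comp (ContinuousLinearMap.fst ℝ _ _) -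
    ∑ k ∈ z.1.1, (z.1.2 k • (lp.evalCLM ℝ _ ⊤ (TestVector.unit k)).comp
      (ContinuousLinearMap.fst ℝ _ _) -
      (z.1.2 k * Real.log (z.1.2 k)) • (lp.evalCLM ℝ _ 2 k).comp (ContinuousLinearMap.snd ℝ _ _))

/-- The Kalton--Peck twisted sum of `ℓ₂` with itself: pairs `(y, x)`, `y` being encoded by the
bounded function `z ↦ ⟨y, z⟩ - ⟨x, z log |z|⟩`. -/
noncomputable def twistedHilbert : Submodule ℝ (lp (fun _ : TestVector => ℝ) ⊤ × ell2) :=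
  ⨅ z, (twistedRelation z).ker

theorem mem_twistedHilbert {w : lp (fun _ : TestVector => ℝ) ⊤ × ell2} :
    w ∈ twistedHilbert ↔ ∀ z : TestVector, w.1 z = ∑ k ∈ z.1.1,
      (z.1.2 k * w.1 (TestVector.unit k) - z.1.2 k * Real.log (z.1.2 k) * w.2 k) := by
  simp only [twistedHilbert, Submodule.mem_iInf]
  refine forall_congr' fun z => ?_
  rw [← sub_eq_zero]
  simp [twistedRelation]
  rfl

instance : CompleteSpace twistedHilbert := by
  have : IsClosed (twistedHilbert : Set (lp (fun _ : TestVector => ℝ) ⊤ × ell2)) := by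
    simp only [twistedHilbert, Submodule.coe_iInf]
    exact isClosed_iInter fun z => (twistedRelation z).isClosed_ker
  exact this.completeSpace_coe

theorem exists_bounded_function {ι : Type*} (g : ι → ℝ) (C : ℝ) (hC : 0 ≤ C)
    (h : ∀ z, |g z| ≤ C) : ∃ G : lp (fun _ : ι => ℝ) ⊤, (∀ z, G z = g z) ∧ ‖G‖ ≤ C :=
  ⟨⟨g, memℓp_infty ⟨C, by rintro _ ⟨z, rfl⟩; exact h z⟩⟩, fun _ => rfl,
    lp.norm_le_of_forall_le hC h⟩

theorem abs_sum_mul_le (z : TestVector) (y : ell2) : |∑ k ∈ z.1.1, z.1.2 k * y k| ≤ ‖y‖ := by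
  refine abs_le_of_sq_le_sq ?_ (norm_nonneg y)
  calc (∑ k ∈ z.1.1, z.1.2 k * y k) ^ 2
      ≤ (∑ k ∈ z.1.1, z.1.2 k ^ 2) * ∑ k ∈ z.1.1, y k ^ 2 := sum_mul_sq_le_sq_mul_sq _ _ _
    _ ≤ 1 * ‖y‖ ^ 2 := by
      gcongr
      · exact z.2
      · exact sum_sq_le_norm_sq y _
    _ = ‖y‖ ^ 2 := one_mul _

theorem TestVector.sum_unit (k : ℕ) (y : ell2) :
    ∑ l ∈ (unit k).1.1, (unit k).1.2 l * y l = y k := by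
  simp [unit]

/-- The inclusion `y ↦ (y, 0)`. -/
theorem exists_twistedInclusion : ∃ i : ell2 →L[ℝ] twistedHilbert,
    ∀ y, (∀ z : TestVector, (i y).1.1 z = ∑ k ∈ z.1.1, z.1.2 k * y k) ∧ (i y).1.2 = 0 := by
  choose G hG hGn using fun y : ell2 => exists_bounded_function
    (fun z : TestVector => ∑ k ∈ z.1.1, z.1.2 k * y k) ‖y‖ (norm_nonneg y)
    (fun z => abs_sum_mul_le z y)
  refine ⟨LinearMap.mkContinuous
    { toFun := fun y => ⟨(G y, 0), mem_twistedHilbert.2 fun z => by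
        simp [hG, TestVector.sum_unit]⟩
      map_add' := fun y y' => by
        refine Subtype.ext (Prod.ext (lp.ext (funext fun z => ?_)) (by simp))
        simp [hG, mul_add, sum_add_distrib]
      map_smul' := fun c y => by
        refine Subtype.ext (Prod.ext (lp.ext (funext fun z => ?_)) (by simp))
        simp [hG, mul_sum, mul_left_comm] }
    1 fun y => ?_, fun y => ⟨hG y, rfl⟩⟩
  rw [one_mul, Submodule.coe_norm]
  simpa [Prod.norm_def] using hGn y

/-- The projection `(y, x) ↦ x`. -/
noncomputable def twistedProjection : twistedHilbert →L[ℝ] ell2 :=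
  (ContinuousLinearMap.snd ℝ _ _).comp twistedHilbert.subtypeL

theorem twistedProjection_apply (w : twistedHilbert) : twistedProjection w = w.1.2 := rfl

/-- A preimage of x is (x log |x|, x): its encoding is bounded by ‖x‖² + 1. This bound need not be
homogeneous, since only membership matters. -/
theorem twistedProjection_surjective : Function.Surjective twistedProjection := by
  intro x
  have hb : ∀ z : TestVector, |∑ k ∈ z.1.1, (z.1.2 k * (x k * Real.log (x k)) -
      z.1.2 k * Real.log (z.1.2 k) * x k)| ≤ ‖x‖ ^ 2 + 1 := fun z => by
    refine (abs_sum_le_sum_abs _ _).trans ?_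
    calc _ ≤ ∑ k ∈ z.1.1, (x k ^ 2 + z.1.2 k ^ 2) := sum_le_sum fun k _ => by
          have := abs_mul_log_sub_mul_log_le (x k) (z.1.2 k)
          rwa [mul_comm (x k * Real.log (x k)), mul_comm (x k) (z.1.2 k * _)] at this
      _ = ∑ k ∈ z.1.1, x k ^ 2 + ∑ k ∈ z.1.1, z.1.2 k ^ 2 := sum_add_distrib
      _ ≤ _ := add_le_add (sum_sq_le_norm_sq x _) z.2
  obtain ⟨G, hG, -⟩ := exists_bounded_function _ _ (by positivity) hb
  refine ⟨⟨(G, x), mem_twistedHilbert.2 fun z => ?_⟩, rfl⟩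
  have : ∀ k, G (TestVector.unit k) = x k * Real.log (x k) := fun k => by
    rw [hG]
    simp [TestVector.unit]
  simp [this, hG]

/-- The twisted sum is an extension of `ℓ₂` by `ℓ₂`. -/
theorem isShortExact_twisted {i : ell2 →L[ℝ] twistedHilbert}
    (hi : ∀ y, (∀ z : TestVector, (i y).1.1 z = ∑ k ∈ z.1.1, z.1.2 k * y k) ∧ (i y).1.2 = 0) :
    IsShortExact i twistedProjection := by
  refine ⟨?_, fun w => ⟨fun hw => ?_, ?_⟩, twistedProjection_surjective⟩
  · rw [injective_iff_map_eq_zero]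
    intro y hy
    refine lp.ext (funext fun k => ?_)
    rw [← TestVector.sum_unit, ← (hi y).1, hy]
    rfl
  · rw [twistedProjection_apply] at hw
    have hrel : ∀ z : TestVector,
        w.1.1 z = ∑ k ∈ z.1.1, z.1.2 k * w.1.1 (TestVector.unit k) := fun z => by
      have := mem_twistedHilbert.1 w.2 z
      simpa [hw] using this
    obtain ⟨y, hy, -⟩ := exists_ell2_of_sum_sq_le (fun k => w.1.1 (TestVector.unit k))
      (norm_nonneg w.1.1) fun s => by
        set A := ∑ k ∈ s, w.1.1 (TestVector.unit k) ^ 2 with hA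
        have hA0 : 0 ≤ A := sum_nonneg fun _ _ => sq_nonneg _
        rcases hA0.eq_or_lt with h0 | h0
        · rw [← h0]
          positivity
        -- The normalised restriction of y to s, which attains the ℓ₂ norm of that restriction.
        let z : TestVector := ⟨(s, fun k => w.1.1 (TestVector.unit k) / √A), by
          simp only [div_pow, ← sum_div, Real.sq_sqrt hA0]
          exact (div_self h0.ne').le⟩
        have hz : w.1.1 z = √A := by
          rw [hrel]
          simp only [z, div_mul_eq_mul_div, ← sum_div, ← sq]
          rw [← hA, Real.div_sqrt]
        have := lp.norm_apply_le_norm (by simp) w.1.1 z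
        rw [hz, Real.norm_of_nonneg (Real.sqrt_nonneg _)] at this
        exact (Real.sqrt_le_left (norm_nonneg _)).1 this
    refine ⟨y, Subtype.ext (Prod.ext (lp.ext (funext fun z => ?_)) ?_)⟩
    · rw [(hi y).1, hrel]
      simp [hy]
    · rw [(hi y).2, hw]
  · rintro ⟨y, rfl⟩
    exact (hi y).2

/-- The quotient map of the twisted sum has no bounded linear right inverse. -/
theorem not_exists_section_twistedProjection :
    ¬ ∃ s : ell2 →L[ℝ] twistedHilbert, ∀ x, twistedProjection (s x) = x := by
  rintro ⟨s, hs⟩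
  let e : ℕ → ell2 := fun k => lp.single 2 k 1
  have he : ∀ k, ‖e k‖ = 1 := fun k => by simp [e]
  have hb : ∀ x z, |(s x).1.1 z| ≤ ‖s‖ * ‖x‖ := fun x z =>
    (lp.norm_apply_le_norm (by simp) (s x).1.1 z).trans
      ((norm_fst_le (s x).1).trans (s.le_opNorm x))
  -- Apply s to sign vectors x of length n and evaluate at z = x/√n. Averaging over signs kills the
  -- off-diagonal terms; the diagonal and the whole average are each at most √n ‖s‖ in modulus,
  -- whereas the logarithmic term equals √n (log n)/2. Hence the constant 4.
  have hlog : ∀ n : ℕ, 1 ≤ n → Real.log n ≤ 4 * ‖s‖ := by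
    intro n hn
    have hn0 : (0 : ℝ) < n := by exact_mod_cast hn
    have hsn : (0 : ℝ) < √n := Real.sqrt_pos.2 hn0
    let f : (Fin n → Bool) → ℕ → ℝ := fun ε k => if h : k < n then sgn (ε ⟨k, h⟩) else 0
    have hf : ∀ ε (k : Fin n), f ε k = sgn (ε k) := fun ε k => by simp [f]
    have hf2 : ∀ ε, ∑ k ∈ range n, f ε k ^ 2 = n := fun ε => by
      rw [sum_range]
      simp [hf, sq, sgn_mul_self]
    let x : (Fin n → Bool) → ell2 := fun ε => ∑ k ∈ range n, lp.single 2 k (f ε k)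
    have hxe : ∀ ε, x ε = ∑ j : Fin n, sgn (ε j) • e j := fun ε => by
      simp only [x, e, sum_range, hf, ← lp.single_smul, smul_eq_mul, mul_one]
    have hxk : ∀ ε, ∀ k ∈ range n, x ε k = f ε k := fun ε k hk => by
      simp only [x, lp.coeFn_sum, Finset.sum_apply, lp.single_apply]
      simp [Pi.single_apply, mem_range.1 hk]
    have hxn : ∀ ε, ‖x ε‖ ≤ √n := fun ε => by
      refine Real.le_sqrt_of_sq_le (le_of_eq ?_)
      have := lp.norm_sum_single (E := fun _ : ℕ => ℝ) (p := 2) (by norm_num) (f ε) (range n)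
      simpa [hf2] using this
    let z : (Fin n → Bool) → TestVector := fun ε => ⟨(range n, fun k => f ε k / √n), by
      simp only [div_pow, ← sum_div, hf2, Real.sq_sqrt hn0.le]
      exact (div_self hn0.ne').le⟩
    have hlogf : ∀ ε (k : Fin n), Real.log (f ε k / √n) = -(Real.log n / 2) := fun ε k => by
      rw [hf, ← Real.log_abs, abs_div, abs_sgn, abs_of_pos hsn, one_div, Real.log_inv,
        Real.log_sqrt hn0.le]
    have hlin : ∀ ε (t : TestVector), (s (x ε)).1.1 t = ∑ j : Fin n,
        sgn (ε j) * (s (e j)).1.1 t := fun ε t => by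
      rw [hxe, map_sum]
      simp only [map_smul]
      have : ∀ w : twistedHilbert, w.1.1 t = lp.evalCLM ℝ (fun _ : TestVector => ℝ) ⊤ t
        (ContinuousLinearMap.fst ℝ _ _ (twistedHilbert.subtypeL w)) := fun w => rfl
      simp only [this, map_sum, map_smul, smul_eq_mul]
    have hval : ∀ ε, (s (x ε)).1.1 (z ε) = (√n)⁻¹ * (∑ k : Fin n, ∑ j : Fin n,
        (s (e j)).1.1 (TestVector.unit k) * (sgn (ε j) * sgn (ε k))) + √n * (Real.log n / 2) := by
      intro ε
      have hx2 : (s (x ε)).1.2 = x ε := hs (x ε)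
      rw [mem_twistedHilbert.1 (s (x ε)).2 (z ε), hx2]
      change ∑ k ∈ range n, (f ε k / √n * _ - f ε k / √n * Real.log (f ε k / √n) * x ε k) = _
      rw [sum_congr rfl fun k hk => by rw [hxk ε k hk], sum_range, sum_sub_distrib, mul_sum]
      simp only [hlogf, hlin]
      simp only [hf]
      rw [sub_eq_add_neg, ← sum_neg_distrib]
      congr 1
      · refine sum_congr rfl fun k _ => ?_
        rw [mul_sum, mul_sum]
        refine sum_congr rfl fun j _ => ?_
        ring
      · have : ∀ k : Fin n, -(sgn (ε k) / √n * -(Real.log n / 2) * sgn (ε k)) =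
            (√n)⁻¹ * (Real.log n / 2) := fun k => by
          linear_combination ((√n)⁻¹ * (Real.log n / 2)) * sgn_mul_self (ε k)
        simp only [this, sum_const, card_univ, Fintype.card_fin, nsmul_eq_mul]
        rw [← mul_assoc, ← div_eq_mul_inv, Real.div_sqrt]
    have havg : signAvg n (fun ε => (s (x ε)).1.1 (z ε)) =
        (√n)⁻¹ * ∑ k : Fin n, (s (e k)).1.1 (TestVector.unit k) + √n * (Real.log n / 2) := by
      simp [hval, signAvg_add, signAvg_const_mul, signAvg_sum, signAvg_const,
        signAvg_sgn_mul_sgn]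
    have h1 : |signAvg n (fun ε => (s (x ε)).1.1 (z ε))| ≤ ‖s‖ * √n :=
      abs_signAvg_le fun ε => (hb _ _).trans (by gcongr; exact hxn ε)
    have h2 : |∑ k : Fin n, (s (e k)).1.1 (TestVector.unit k)| ≤ n * ‖s‖ := by
      refine (abs_sum_le_sum_abs _ _).trans ?_
      refine (sum_le_sum fun (k : Fin n) _ => hb (e k) (TestVector.unit k)).trans ?_
      simp [he]
    rw [havg] at h1
    have h3 := (abs_le.1 h1).2
    have h4 := (abs_le.1 h2).1
    have h5 : -(√n * ‖s‖) ≤ (√n)⁻¹ * ∑ k : Fin n, (s (e k)).1.1 (TestVector.unit k) := by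
      have h := mul_le_mul_of_nonneg_left h4 (inv_nonneg.2 hsn.le)
      refine le_trans (le_of_eq ?_) h
      have : (√n)⁻¹ * (n : ℝ) = √n := by rw [mul_comm, ← div_eq_mul_inv, Real.div_sqrt]
      linear_combination ‖s‖ * this
    have h6 : √n * Real.log n ≤ √n * (4 * ‖s‖) := by nlinarith
    exact le_of_mul_le_mul_left h6 hsn
  obtain ⟨n, hn⟩ := exists_nat_gt (Real.exp (4 * ‖s‖))
  have hn0 : (0 : ℝ) < n := (Real.exp_pos _).trans hn
  have := hlog n (by exact_mod_cast hn0)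
  rw [Real.log_le_iff_le_exp hn0] at this
  linarith

theorem exists_not_splits : ∃ F : Extension ell2 ell2, ¬ F.Splits := by
  obtain ⟨i, hi⟩ := exists_twistedInclusion
  refine ⟨⟨twistedHilbert, i, twistedProjection, isShortExact_twisted hi⟩, ?_⟩
  rw [Extension.splits_iff_section]
  exact not_exists_section_twistedProjection

end TwistedHilbert

open Filter Topology

/-! ### Ultralimits of almost linear maps into ℓ₂ -/

section Ultralimit

theorem hyperfilter_nat_le_atTop : (hyperfilter ℕ : Filter ℕ) ≤ atTop := by
  rw [← Nat.cofinite_eq_atTop]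
  exact hyperfilter_le_cofinite

theorem exists_tendsto_hyperfilter {u : ℕ → ℝ} {C : ℝ} (h : ∀ n, |u n| ≤ C) :
    ∃ l, Tendsto u (hyperfilter ℕ) (𝓝 l) := by
  have hc : IsCompact (Set.Icc (-C) C) := isCompact_Icc
  obtain ⟨l, -, hl⟩ := hc.ultrafilter_le_nhds' ((hyperfilter ℕ).map u)
    (Ultrafilter.mem_map.2 (Filter.univ_mem' fun n => abs_le.1 (h n)))
  exact ⟨l, hl⟩

/-- A uniformly bounded sequence of asymptotically linear maps into `ℓ₂` has a coordinatewise
ultralimit, which is a bounded operator. -/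
theorem exists_ultralimit_operator {W : Type*} [NormedAddCommGroup W] [NormedSpace ℝ W]
    (r : ℕ → W → ell2) (C : ℝ) (hC : 0 ≤ C) (hr : ∀ n w, ‖r n w‖ ≤ C * ‖w‖)
    (hadd : ∀ w w', Tendsto (fun n => r n (w + w') - r n w - r n w') atTop (𝓝 0))
    (hsmul : ∀ (c : ℝ) w, Tendsto (fun n => r n (c • w) - c • r n w) atTop (𝓝 0)) :
    ∃ R : W →L[ℝ] ell2, ∀ w k, Tendsto (fun n => r n w k) (hyperfilter ℕ) (𝓝 (R w k)) := by
  have hlim : ∀ w k, ∃ l, Tendsto (fun n => r n w k) (hyperfilter ℕ) (𝓝 l) := fun w k =>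
    exists_tendsto_hyperfilter fun n => (abs_apply_le_norm (r n w) k).trans (hr n w)
  choose l hl using hlim
  -- Bounds on finite sums of squares survive coordinatewise limits, so the limit sequence is again
  -- in ℓ₂.
  have hmem : ∀ w, ∃ x : ell2, (∀ k, x k = l w k) ∧ ‖x‖ ≤ C * ‖w‖ := fun w => by
    refine exists_ell2_of_sum_sq_le (l w) (by positivity) fun s => ?_
    refine le_of_tendsto (tendsto_finsetSum s fun k _ => (hl w k).pow 2)
      (Eventually.of_forall fun n => (sum_sq_le_norm_sq (r n w) s).trans ?_)
    have := hr n w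
    gcongr
  choose R hR hRn using hmem
  have hev : ∀ (u : ℕ → ell2) k, Tendsto u atTop (𝓝 0) →
      Tendsto (fun n => u n k) (hyperfilter ℕ) (𝓝 0) := fun u k hu => by
    have := ((lp.evalCLM ℝ (fun _ : ℕ => ℝ) 2 k).continuous.tendsto 0).comp hu
    rw [map_zero] at this
    exact this.mono_left hyperfilter_nat_le_atTop
  refine ⟨LinearMap.mkContinuous
    { toFun := R
      map_add' := fun w w' => lp.ext (funext fun k => ?_)
      map_smul' := fun c w => lp.ext (funext fun k => ?_) } C hRn, fun w k => ?_⟩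
  · have h1 := hev _ k (hadd w w')
    have h2 := ((hl (w + w') k).sub (hl w k)).sub (hl w' k)
    have h3 := tendsto_nhds_unique h2 h1
    simp only [lp.coeFn_add, Pi.add_apply, hR]
    linarith
  · have h1 := hev _ k (hsmul c w)
    have h2 := (hl (c • w) k).sub ((hl w k).const_mul c)
    have h3 := tendsto_nhds_unique h2 h1
    simp only [lp.coeFn_smul, Pi.smul_apply, hR, RingHom.id_apply, smul_eq_mul]
    linarith
  · change Tendsto _ _ (𝓝 (R w k))
    rw [hR]
    exact hl w k

end Ultralimit

/-! ### Injectivity of `ℓ_∞` and its quotient ℓ₂ -/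

section EllInfty

/-- `ℓ_∞` is an injective Banach space: every extension of a Banach space by `ℓ_∞` splits. -/
theorem splits_of_ellInfty {X : Type} [NormedAddCommGroup X] [NormedSpace ℝ X] [CompleteSpace X]
    (H : Extension X ellInfty) : H.Splits := by
  let e := H.i.equivRange H.isShortExact.injective H.isShortExact.isClosed_range
  let φ : ℕ → StrongDual ℝ H.i.range := fun n =>
    (lp.evalCLM ℝ (fun _ : ℕ => ℝ) ⊤ n).comp e.symm.toContinuousLinearMap
  let M := ‖e.symm.toContinuousLinearMap‖
  have hφ : ∀ n, ‖φ n‖ ≤ M := fun n => by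
    refine ContinuousLinearMap.opNorm_le_bound _ (norm_nonneg e.symm.toContinuousLinearMap)
      fun w => ?_
    exact (lp.norm_apply_le_norm (by simp) (e.symm w) n).trans
      (e.symm.toContinuousLinearMap.le_opNorm w)
  -- Hahn–Banach preserves norms, so the coordinate functionals extend with the common bound M and
  -- reassemble into a map to `ℓ_∞`.
  choose g hg hgn using fun n => exists_extension_norm_eq H.i.range (φ n)
  have hb : ∀ w n, |g n w| ≤ M * ‖w‖ := fun w n =>
    ((g n).le_opNorm w).trans (by rw [hgn]; gcongr; exact hφ n)
  choose r hr hrn using fun w => exists_bounded_function (fun n => g n w) (M * ‖w‖)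
    (by positivity) (hb w)
  refine H.splits_iff_retraction.2 ⟨LinearMap.mkContinuous
    { toFun := r
      map_add' := fun w w' => lp.ext (funext fun k => ?_)
      map_smul' := fun c w => lp.ext (funext fun k => ?_) } M hrn, fun y => ?_⟩
  · simp [hr]
  · simp [hr]
  · refine lp.ext (funext fun n => ?_)
    change r (H.i y) n = y n
    rw [hr]
    have h1 : g n (H.i y) = φ n (e y) := hg n (e y)
    rw [h1]
    change (e.symm (e y)) n = y n
    rw [e.symm_apply_apply]

/-- `ℓ₂` is a quotient of `ℓ_∞`. -/
theorem exists_surjection_ellInfty : ∃ Q : ellInfty →L[ℝ] ell2, Function.Surjective Q := by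
  have : Infinite (Σ n : ℕ, Fin n → Bool) :=
    Infinite.of_injective (fun n => ⟨n, fun _ => true⟩) fun m n h => congrArg Sigma.fst h
  obtain ⟨e⟩ := nonempty_equiv_of_countable (α := Σ n : ℕ, Fin n → Bool) (β := ℕ)
  -- Through `e`, a bounded sequence is a function on the disjoint union of all sign cubes. `c n f`
  -- lists its sign coefficients on the n-th cube, padded by zeros; Bessel bounds them in ℓ₂.
  let c : ℕ → ellInfty → ℕ → ℝ := fun n f k =>
    if h : k < n then signAvg n (fun ε => f (e ⟨n, ε⟩) * sgn (ε ⟨k, h⟩)) else 0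
  have hc : ∀ n f s, ∑ k ∈ s, c n f k ^ 2 ≤ ‖f‖ ^ 2 := fun n f s => by
    have h1 : ∑ k ∈ s, c n f k ^ 2 ≤ ∑ k ∈ Finset.range n, c n f k ^ 2 :=
      (Finset.sum_le_sum_of_subset_of_nonneg Finset.subset_union_left
        fun _ _ _ => sq_nonneg _).trans_eq
        (Finset.sum_subset (Finset.subset_union_right (s₁ := s)) fun k _ hk => by
          simp [c, Finset.mem_range.not.1 hk]).symm
    refine h1.trans ?_
    rw [Finset.sum_range]
    have h2 := sum_sq_signAvg_le (fun ε => f (e ⟨n, ε⟩))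
    simp only [c, Fin.is_lt, dif_pos, Fin.eta]
    refine h2.trans ?_
    rw [← signAvg_const (n := n) (‖f‖ ^ 2)]
    refine signAvg_mono fun ε => sq_le_sq.2 ?_
    rw [abs_norm]
    exact lp.norm_apply_le_norm (by simp) f _
  choose r hr hrn using fun n f => exists_ell2_of_sum_sq_le (c n f) (norm_nonneg f) (hc n f)
  have hcadd : ∀ n f g k, c n (f + g) k = c n f k + c n g k := fun n f g k => by
    by_cases h : k < n
    · simp [c, h, add_mul, signAvg_add]
    · simp [c, h]
  have hcsmul : ∀ n (a : ℝ) f k, c n (a • f) k = a * c n f k := fun n a f k => by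
    by_cases h : k < n
    · simp [c, h, mul_assoc, signAvg_const_mul]
    · simp [c, h]
  obtain ⟨Q, hQ⟩ := exists_ultralimit_operator r 1 zero_le_one (by simpa using hrn)
    (fun f g => by
      have : ∀ n, r n (f + g) - r n f - r n g = 0 := fun n =>
        lp.ext (funext fun k => by simp [hr, hcadd])
      simp [this])
    (fun a f => by
      have : ∀ n, r n (a • f) - a • r n f = 0 := fun n =>
        lp.ext (funext fun k => by
          change r n (a • f) k - a * r n f k = 0
          rw [hr, hr, hcsmul, sub_self])
      simp [this])
  refine ⟨Q, fun a => ?_⟩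
  -- On the n-th cube f is the Riesz product of the first n coordinates of a, so its k-th
  -- coefficient is exactly a k as soon as n > k.
  obtain ⟨f, hf, -⟩ := exists_bounded_function
    (fun m => rieszProduct (fun k => a k) (e.symm m).2) (Real.exp (‖a‖ ^ 2)) (Real.exp_pos _).le
    fun m => (abs_rieszProduct_le _ _).trans (Real.exp_le_exp.2 (by
      have := sum_sq_le_norm_sq a (Finset.range (e.symm m).1)
      rwa [Finset.sum_range] at this))
  refine ⟨f, lp.ext (funext fun k => ?_)⟩
  refine tendsto_nhds_unique (hQ f k) (tendsto_const_nhds.congr' ?_)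
  refine hyperfilter_nat_le_atTop ?_
  filter_upwards [eventually_gt_atTop k] with n hn
  rw [hr]
  simp only [c, hn, dif_pos, hf]
  have h := signAvg_rieszProduct_mul_sgn (fun k : Fin n => a k) ⟨k, hn⟩
  rw [← h]
  congr 1
  funext ε
  rw [e.symm_apply_apply]

theorem isShortExact_subtypeL_ker {E X : Type u} [NormedAddCommGroup E] [NormedSpace ℝ E]
    [NormedAddCommGroup X] [NormedSpace ℝ X] (Q : E →L[ℝ] X) (hQ : Function.Surjective Q) :
    IsShortExact Q.ker.subtypeL Q :=
  ⟨Subtype.val_injective, fun e => ⟨fun h => ⟨⟨e, h⟩, rfl⟩, by rintro ⟨y, rfl⟩; exact y.2⟩, hQ⟩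

end EllInfty

/-! ### Splitting by approximation through finite-dimensional ℓ₁ -/

section LocalLifting

/-- If the identity of `W` is a pointwise limit of operators factoring through finite-dimensional
`ℓ₁` spaces with uniform bounds, then every extension of `W` by `ℓ₂` splits. -/
theorem splits_of_approximation {W : Type} [NormedAddCommGroup W] [NormedSpace ℝ W]
    [CompleteSpace W] (s : ℕ → Finset ℕ) (φ : ℕ → ℕ → W →L[ℝ] ℝ) (u : ℕ → ℕ → W)
    (hb : ∀ n w, ∑ k ∈ s n, |φ n k w| * ‖u n k‖ ≤ ‖w‖)
    (hlim : ∀ w, Tendsto (fun n => ∑ k ∈ s n, φ n k w • u n k) atTop (𝓝 w))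
    (H : Extension W ell2) : H.Splits := by
  have hH := H.isShortExact
  let B := H.q.nonlinearRightInverseOfSurjective (LinearMap.range_eq_top.2 hH.surjective)
  obtain ⟨C, hC, hBC⟩ : ∃ C : ℝ, 0 ≤ C ∧ ∀ w, ‖B w‖ ≤ C * ‖w‖ := ⟨B.nnnorm, B.nnnorm.2, B.bound⟩
  have hB : ∀ w, H.q (B w) = w := B.right_inv
  obtain ⟨K, hK⟩ := ContinuousLinearMap.antilipschitz_of_injective_of_isClosed_range H.i
    hH.injective hH.isClosed_range
  have hK' : ∀ y, ‖y‖ ≤ K * ‖H.i y‖ := fun y => hK.le_mul_norm (map_zero _) y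
  let P : ℕ → W →L[ℝ] W := fun n => ∑ k ∈ s n, (φ n k).smulRight (u n k)
  -- Lifting only the vectors `u n k` keeps `σ n` linear; the ℓ₁-type bound `hb` makes its norm at
  -- most C for every n.
  let σ : ℕ → W →L[ℝ] H.space := fun n => ∑ k ∈ s n, (φ n k).smulRight (B (u n k))
  have hP : ∀ n w, P n w = ∑ k ∈ s n, φ n k w • u n k := fun n w => by simp [P]
  have hσ : ∀ n w, σ n w = ∑ k ∈ s n, φ n k w • B (u n k) := fun n w => by simp [σ]
  have hPn : ∀ n w, ‖P n w‖ ≤ ‖w‖ := fun n w => by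
    rw [hP]
    refine (norm_sum_le _ _).trans (le_trans (le_of_eq ?_) (hb n w))
    simp [norm_smul]
  have hσn : ∀ n w, ‖σ n w‖ ≤ C * ‖w‖ := fun n w => by
    rw [hσ]
    refine (norm_sum_le _ _).trans ?_
    refine le_trans ?_ (mul_le_mul_of_nonneg_left (hb n w) hC)
    rw [Finset.mul_sum]
    refine Finset.sum_le_sum fun k _ => ?_
    rw [norm_smul, Real.norm_eq_abs, mul_left_comm]
    gcongr
    exact hBC _
  have hqσ : ∀ n w, H.q (σ n w) = P n w := fun n w => by simp [hσ, hP, hB]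
  -- A nonlinear correction, tending to 0, that puts d - σ(q d) - β(d) in the kernel of q, that is,
  -- in the range of ℓ₂.
  let β : ℕ → H.space → H.space := fun n d => B (H.q d - P n (H.q d))
  have hβ0 : ∀ d, Tendsto (fun n => β n d) atTop (𝓝 0) := fun d => by
    have h1 : Tendsto (fun n => C * ‖H.q d - P n (H.q d)‖) atTop (𝓝 0) := by
      have := ((hlim (H.q d)).const_sub (H.q d)).norm.const_mul C
      simpa [hP] using this
    exact squeeze_zero_norm (fun n => hBC _) h1
  have hex : ∀ n d, ∃ y, H.i y = d - σ n (H.q d) - β n d := fun n d =>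
    hH.exists_of_eq_zero (by simp [β, hB, hqσ])
  choose r hr using hex
  have htend : ∀ (y : ℕ → ell2), Tendsto (fun n => H.i (y n)) atTop (𝓝 0) →
      Tendsto y atTop (𝓝 0) := fun y hy => by
    refine squeeze_zero_norm (fun n => hK' _) ?_
    simpa using hy.norm.const_mul (K : ℝ)
  -- In the constant, 1 accounts for d, one C‖q‖ for `σ`, and two for `β`, whose argument is a
  -- difference of two vectors of norm at most ‖q‖‖d‖.
  obtain ⟨R, hR⟩ := exists_ultralimit_operator r (K * (1 + 3 * (C * ‖H.q‖))) (by positivity)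
    (fun n d => by
      refine (hK' _).trans ?_
      rw [mul_assoc]
      gcongr
      rw [hr]
      have h1 : ‖σ n (H.q d)‖ ≤ C * (‖H.q‖ * ‖d‖) :=
        (hσn _ _).trans (by gcongr; exact H.q.le_opNorm d)
      have h2 : ‖β n d‖ ≤ C * (‖H.q‖ * ‖d‖ + ‖H.q‖ * ‖d‖) := by
        refine (hBC _).trans ?_
        gcongr
        refine (norm_sub_le _ _).trans ?_
        exact add_le_add (H.q.le_opNorm d) ((hPn _ _).trans (H.q.le_opNorm d))
      have h3 := norm_sub_le (d - σ n (H.q d)) (β n d)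
      have h4 := norm_sub_le d (σ n (H.q d))
      linarith)
    (fun d d' => by
      refine htend _ ?_
      have h1 := ((hβ0 d).add (hβ0 d')).sub (hβ0 (d + d'))
      simp only [add_zero, sub_zero] at h1
      refine h1.congr fun n => ?_
      simp only [map_sub, hr, map_add]
      abel)
    (fun c d => by
      refine htend _ ?_
      have h1 := ((hβ0 d).const_smul c).sub (hβ0 (c • d))
      simp only [smul_zero, sub_zero] at h1
      refine h1.congr fun n => ?_
      simp only [map_sub, hr, map_smul, smul_sub]
      abel)
  refine H.splits_iff_retraction.2 ⟨R, fun y => lp.ext (funext fun k => ?_)⟩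
  refine tendsto_nhds_unique (hR (H.i y) k) (tendsto_const_nhds.congr fun n => ?_)
  have : r n (H.i y) = y := hH.injective (by
    have hB0 : B 0 = 0 := norm_le_zero_iff.1 (by simpa using hBC 0)
    simp [hr, hH.apply_apply, β, hB0])
  rw [this]

end LocalLifting

/-! ### Averaging operators on L₁(0,1) -/

section LOne

open MeasureTheory Set

/-- Lebesgue measure on the open unit interval. -/
noncomputable abbrev unitMeasure : Measure ℝ := volume.restrict (Ioo (0 : ℝ) 1)

/-- The `k`-th of the intervals of length `1 / (n + 1)` that partition `(0, 1]`. -/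
def gridInterval (n k : ℕ) : Set ℝ := Ioc ((k : ℝ) / (n + 1)) (((k : ℝ) + 1) / (n + 1))

theorem measurableSet_gridInterval (n k : ℕ) : MeasurableSet (gridInterval n k) :=
  measurableSet_Ioc

theorem pairwise_disjoint_gridInterval (n : ℕ) :
    Pairwise (Function.onFun Disjoint (gridInterval n)) := by
  have hm : Monotone fun k : ℕ => (k : ℝ) / (n + 1) := fun a b h => by
    simp only
    gcongr
  have := hm.pairwise_disjoint_on_Ioc_succ
  have h : gridInterval n = fun k : ℕ => Ioc ((k : ℝ) / (n + 1)) (((k : ℝ) + 1) / (n + 1)) := rfl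
  rw [h]
  simpa using this

theorem unitMeasure_real_gridInterval {n k : ℕ} (hk : k < n + 1) :
    unitMeasure.real (gridInterval n k) = (n + 1 : ℝ)⁻¹ := by
  have hn : (0 : ℝ) < n + 1 := by positivity
  rw [unitMeasure, Measure.restrict_congr_set Ioo_ae_eq_Ioc,
    measureReal_restrict_apply (measurableSet_gridInterval n k), inter_eq_self_of_subset_left]
  · rw [gridInterval, Real.volume_real_Ioc_of_le (by gcongr; linarith)]
    field_simp
    ring
  · refine Ioc_subset_Ioc (by positivity) ?_
    rw [div_le_one hn]
    have : (k + 1 : ℕ) ≤ n + 1 := hk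
    exact_mod_cast this

theorem exists_mem_gridInterval (n : ℕ) {x : ℝ} (hx : x ∈ Ioo (0 : ℝ) 1) :
    ∃ k ∈ Finset.range (n + 1), x ∈ gridInterval n k := by
  have hn : (0 : ℝ) < n + 1 := by positivity
  have h0 : 0 < x * (n + 1) := mul_pos hx.1 hn
  have hc : 1 ≤ ⌈x * (n + 1)⌉₊ := Nat.one_le_ceil_iff.2 h0
  -- The cells are open on the left, so the index of the cell of x is ⌈x(n + 1)⌉ - 1.
  obtain ⟨k, hk⟩ := Nat.exists_eq_add_of_le' hc
  have h1 := Nat.ceil_lt_add_one h0.le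
  have h2 := Nat.le_ceil (x * (n + 1))
  rw [hk] at h1 h2
  push_cast at h1 h2
  refine ⟨k, Finset.mem_range.2 ?_, ?_, ?_⟩
  · have : (k : ℝ) < n + 1 := by nlinarith [hx.2]
    exact_mod_cast this
  · rw [div_lt_iff₀ hn]
    linarith
  · rw [le_div_iff₀ hn]
    linarith

/-- Integration over a measurable set as a functional on `L₁`. -/
theorem exists_setIntegralCLM (t : Set ℝ) :
    ∃ φ : L1 →L[ℝ] ℝ, ∀ f : L1, φ f = ∫ x in t, f x ∂unitMeasure := by
  refine ⟨LinearMap.mkContinuous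
    { toFun := fun f => ∫ x in t, f x ∂unitMeasure
      map_add' := fun f g => ?_
      map_smul' := fun c f => ?_ } 1 fun f => ?_, fun f => rfl⟩
  · rw [← integral_add (L1.integrable_coeFn f).integrableOn (L1.integrable_coeFn g).integrableOn]
    exact integral_congr_ae (ae_restrict_of_ae (Lp.coeFn_add f g))
  · rw [RingHom.id_apply, smul_eq_mul, ← integral_const_mul]
    exact integral_congr_ae (ae_restrict_of_ae (Lp.coeFn_smul c f))
  · rw [one_mul, L1.norm_eq_integral_norm]
    refine (norm_integral_le_integral_norm _).trans ?_
    exact setIntegral_le_integral (L1.integrable_coeFn f).norm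
      (Eventually.of_forall fun x => norm_nonneg _)

/-- The indicator functions of the grid intervals, as elements of `L₁`. -/
noncomputable def gridIndicator (n k : ℕ) : L1 :=
  indicatorConstLp 1 (measurableSet_gridInterval n k) (measure_ne_top unitMeasure _) (1 : ℝ)

theorem norm_gridIndicator {n k : ℕ} (hk : k < n + 1) : ‖gridIndicator n k‖ = (n + 1 : ℝ)⁻¹ := by
  rw [gridIndicator, norm_indicatorConstLp one_ne_zero ENNReal.one_ne_top]
  simp only [norm_one, ENNReal.toReal_one, div_one, Real.rpow_one, one_mul]
  exact unitMeasure_real_gridInterval hk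

/-- The averaging functionals on the grid intervals. -/
noncomputable def gridAverage (n k : ℕ) : L1 →L[ℝ] ℝ :=
  ((n : ℝ) + 1) • (exists_setIntegralCLM (gridInterval n k)).choose

theorem gridAverage_apply (n k : ℕ) (f : L1) :
    gridAverage n k f = (n + 1) * ∫ x in gridInterval n k, f x ∂unitMeasure := by
  rw [gridAverage, smul_apply,
    (exists_setIntegralCLM (gridInterval n k)).choose_spec, smul_eq_mul]

theorem sum_gridAverage_le (n : ℕ) (f : L1) :
    ∑ k ∈ Finset.range (n + 1), |gridAverage n k f| * ‖gridIndicator n k‖ ≤ ‖f‖ := by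
  have hn : (0 : ℝ) < n + 1 := by positivity
  have hf := (L1.integrable_coeFn f).norm
  calc ∑ k ∈ Finset.range (n + 1), |gridAverage n k f| * ‖gridIndicator n k‖
      ≤ ∑ k ∈ Finset.range (n + 1), ∫ x in gridInterval n k, ‖f x‖ ∂unitMeasure := by
        refine Finset.sum_le_sum fun k hk => ?_
        rw [norm_gridIndicator (Finset.mem_range.1 hk), gridAverage_apply, abs_mul,
          abs_of_pos hn, mul_comm, ← mul_assoc, inv_mul_cancel₀ hn.ne', one_mul]
        exact norm_integral_le_integral_norm (f : ℝ → ℝ)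
    _ = ∫ x in ⋃ k ∈ Finset.range (n + 1), gridInterval n k, ‖f x‖ ∂unitMeasure :=
        (integral_biUnion_finset _ (fun k _ => measurableSet_gridInterval n k)
          ((pairwise_disjoint_gridInterval n).set_pairwise _) fun k _ => hf.integrableOn).symm
    _ ≤ ∫ x, ‖f x‖ ∂unitMeasure :=
        setIntegral_le_integral hf (Eventually.of_forall fun x => norm_nonneg _)
    _ = ‖f‖ := (L1.norm_eq_integral_norm f).symm

/-- The averaging operator attached to the partition of `(0, 1]` into `n + 1` equal intervals. -/
noncomputable def gridProjection (n : ℕ) (f : L1) : L1 :=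
  ∑ k ∈ Finset.range (n + 1), gridAverage n k f • gridIndicator n k

theorem norm_gridProjection_le (n : ℕ) (f : L1) : ‖gridProjection n f‖ ≤ ‖f‖ := by
  refine (norm_sum_le _ _).trans (le_trans (le_of_eq ?_) (sum_gridAverage_le n f))
  simp [norm_smul]

theorem gridProjection_sub (n : ℕ) (f g : L1) :
    gridProjection n (f - g) = gridProjection n f - gridProjection n g := by
  simp [gridProjection, sub_smul]

theorem gridProjection_ae_eq (n : ℕ) (f : L1) : ∀ᵐ x ∂unitMeasure,
    ∃ k ∈ Finset.range (n + 1), x ∈ gridInterval n k ∧ gridProjection n f x = gridAverage n k f := by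
  have h1 := Lp.coeFn_fun_finsetSum (Finset.range (n + 1))
    fun k => gridAverage n k f • gridIndicator n k
  have h2 : ∀ᵐ x ∂unitMeasure, ∀ k, (gridAverage n k f • gridIndicator n k : L1) x =
      gridAverage n k f * gridIndicator n k x :=
    ae_all_iff.2 fun k => Lp.coeFn_smul _ _
  have h3 : ∀ᵐ x ∂unitMeasure, ∀ k, gridIndicator n k x =
      (gridInterval n k).indicator (fun _ => (1 : ℝ)) x :=
    ae_all_iff.2 fun k => indicatorConstLp_coeFn
  filter_upwards [h1, h2, h3, ae_restrict_mem measurableSet_Ioo] with x hx1 hx2 hx3 hx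
  obtain ⟨k, hk, hxk⟩ := exists_mem_gridInterval n hx
  refine ⟨k, hk, hxk, ?_⟩
  rw [gridProjection, hx1, Finset.sum_eq_single_of_mem k hk]
  · rw [hx2, hx3, indicator_of_mem hxk, mul_one]
  · intro l _ hlk
    have : x ∉ gridInterval n l := fun hxl =>
      disjoint_left.1 (pairwise_disjoint_gridInterval n hlk) hxl hxk
    rw [hx2, hx3, indicator_of_notMem this, mul_zero]

/-- On each cell the averaged function differs from g by at most its oscillation there, and the
total mass is 1. -/
theorem norm_gridProjection_sub_le (n : ℕ) {g : ℝ → ℝ} (hg : Integrable g unitMeasure) {ε : ℝ}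
    (h : ∀ x y, |x - y| ≤ (n + 1 : ℝ)⁻¹ → |g x - g y| ≤ ε) :
    ‖gridProjection n (hg.toL1 g) - hg.toL1 g‖ ≤ ε := by
  have hn : (0 : ℝ) < n + 1 := by positivity
  rw [L1.norm_eq_integral_norm]
  have hb : ∀ᵐ x ∂unitMeasure, ‖‖(gridProjection n (hg.toL1 g) - hg.toL1 g : L1) x‖‖ ≤ ε := by
    filter_upwards [gridProjection_ae_eq n (hg.toL1 g), Lp.coeFn_sub (gridProjection n (hg.toL1 g))
      (hg.toL1 g), hg.coeFn_toL1] with x ⟨k, hk, hxk, hx1⟩ hx2 hx3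
    have hμ := unitMeasure_real_gridInterval (Finset.mem_range.1 hk)
    have hint : ∫ y in gridInterval n k, (hg.toL1 g) y ∂unitMeasure =
        ∫ y in gridInterval n k, g y ∂unitMeasure :=
      integral_congr_ae (ae_restrict_of_ae hg.coeFn_toL1)
    have hsub : gridAverage n k (hg.toL1 g) - g x =
        (n + 1) * ∫ y in gridInterval n k, (g y - g x) ∂unitMeasure := by
      rw [integral_sub hg.integrableOn (integrable_const _), setIntegral_const, hμ,
        gridAverage_apply, hint, smul_eq_mul, mul_sub, ← mul_assoc, mul_inv_cancel₀ hn.ne', one_mul]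
    have hle := norm_setIntegral_le_of_norm_le_const (μ := unitMeasure) (s := gridInterval n k)
      (f := fun y => g y - g x) (C := ε) (measure_lt_top _ _) fun y hy => h y x (by
        have hl : ((k : ℝ) + 1) / (n + 1) - k / (n + 1) = (n + 1 : ℝ)⁻¹ := by
          field_simp
          ring
        have h1 := hy.1
        have h2 := hy.2
        have h3 := hxk.1
        have h4 := hxk.2
        rw [abs_le]
        constructor <;> linarith)
    rw [norm_norm, hx2, Pi.sub_apply, hx1, hx3, hsub, norm_mul, Real.norm_of_nonneg hn.le]
    calc _ ≤ (n + 1 : ℝ) * (ε * unitMeasure.real (gridInterval n k)) := by gcongr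
      _ = ε := by
        rw [hμ]
        field_simp
  have := norm_integral_le_of_norm_le_const hb
  have hμ1 : unitMeasure.real univ = 1 := by simp [unitMeasure]
  rw [hμ1, mul_one] at this
  exact (le_abs_self _).trans this

/-- The averaging operators are contractions, so it is enough to treat the dense set of continuous
compactly supported functions, which are uniformly continuous. -/
theorem tendsto_gridProjection (f : L1) : Tendsto (fun n => gridProjection n f) atTop (𝓝 f) := by
  rw [Metric.tendsto_atTop]
  intro ε hε
  obtain ⟨g, hgs, hfg, hgc, hg⟩ := (L1.integrable_coeFn f).exists_hasCompactSupport_integral_sub_le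
    (show 0 < ε / 4 by positivity)
  have huc : UniformContinuous g := 
    hgc.uniformContinuous_of_tendsto_cocompact hgs.is_zero_at_infty
  obtain ⟨δ, hδ, hgδ⟩ := Metric.uniformContinuous_iff.1 huc (ε / 4) (by positivity)
  obtain ⟨N, hN⟩ := exists_nat_one_div_lt hδ
  refine ⟨N, fun n hn => ?_⟩
  have h1 : ‖gridProjection n (hg.toL1 g) - hg.toL1 g‖ ≤ ε / 4 := by
    refine norm_gridProjection_sub_le n hg fun x y hxy => (hgδ (lt_of_le_of_lt hxy ?_)).le
    refine lt_of_le_of_lt ?_ hN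
    rw [one_div]
    gcongr
  have h2 : ‖f - hg.toL1 g‖ ≤ ε / 4 := by
    rw [L1.norm_eq_integral_norm]
    refine le_trans (le_of_eq (integral_congr_ae ?_)) hfg
    filter_upwards [Lp.coeFn_sub f (hg.toL1 g), hg.coeFn_toL1] with x hx1 hx2
    rw [hx1, Pi.sub_apply, hx2]
  have h3 := (norm_gridProjection_le n (f - hg.toL1 g)).trans h2
  have h4 : gridProjection n f - f = gridProjection n (f - hg.toL1 g) +
      (gridProjection n (hg.toL1 g) - hg.toL1 g) - (f - hg.toL1 g) := by
    rw [gridProjection_sub]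
    abel
  rw [dist_eq_norm, h4]
  have h5 := norm_sub_le (gridProjection n (f - hg.toL1 g) +
      (gridProjection n (hg.toL1 g) - hg.toL1 g)) (f - hg.toL1 g)
  have h6 := norm_add_le (gridProjection n (f - hg.toL1 g))
      (gridProjection n (hg.toL1 g) - hg.toL1 g)
  linarith

/-- Every extension of `L₁(0,1)` by `ℓ₂` splits. -/
theorem splits_of_L1 (H : Extension L1 ell2) : H.Splits :=
  splits_of_approximation (fun n => Finset.range (n + 1)) gridAverage gridIndicator
    sum_gridAverage_le tendsto_gridProjection H

end LOne

/-! ### Rademacher functions and the embedding of ℓ₂ in L₁(0,1) -/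

section Rademacher

open MeasureTheory Set

/-- The fair coin. -/
noncomputable def coinMeasure : Measure Bool := (PMF.uniformOfFintype Bool).toMeasure

instance : IsProbabilityMeasure coinMeasure :=
  inferInstanceAs (IsProbabilityMeasure (PMF.uniformOfFintype Bool).toMeasure)

theorem coinMeasure_singleton (b : Bool) : coinMeasure {b} = 2⁻¹ := by
  rw [coinMeasure, PMF.toMeasure_apply_singleton _ _ (measurableSet_singleton b)]
  simp

/-- A sequence of independent fair coins on the unit interval. -/
theorem exists_coins : ∃ θ : ℝ → ℕ → Bool, Measurable θ ∧
    unitMeasure.map θ = Measure.infinitePi fun _ => coinMeasure := by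
  obtain ⟨f, hf, hmap⟩ := Measure.exists_measurable_map_eq
    (Measure.infinitePi fun _ : ℕ => coinMeasure)
  -- `f` lives on the unit interval; `projIcc` extends it to the line, and only the values on [0, 1]
  -- carry mass.
  have hθ : Measurable fun x : ℝ => f (projIcc 0 1 zero_le_one x) :=
    hf.comp continuous_projIcc.measurable
  refine ⟨_, hθ, ?_⟩
  rw [unitMeasure, Measure.restrict_congr_set Ioo_ae_eq_Icc,
    ← unitInterval.measurePreserving_coe.map_eq, Measure.map_map hθ measurable_subtype_coe, ← hmap]
  congr 1
  funext x
  exact congrArg f (projIcc_val zero_le_one x)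

/-- The first n coins are uniformly distributed on the 2ⁿ sign patterns, which turns integrals into
finite averages. -/
theorem integral_coins {θ : ℝ → ℕ → Bool} (hθ : Measurable θ)
    (hmap : unitMeasure.map θ = Measure.infinitePi fun _ => coinMeasure) {n : ℕ}
    (F : (Fin n → Bool) → ℝ) : ∫ x, F (fun k => θ x k) ∂unitMeasure = signAvg n F := by
  let π : (ℕ → Bool) → Fin n → Bool := fun ω k => ω k
  have hπ : Measurable π := by fun_prop
  have hF : Measurable F := measurable_of_finite F
  let ν := (Measure.infinitePi fun _ : ℕ => coinMeasure).map π
  have : IsProbabilityMeasure ν := Measure.isProbabilityMeasure_map hπ.aemeasurable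
  have hν : ∀ ε, ν.real {ε} = (2 ^ n)⁻¹ := fun ε => by
    have hset : π ⁻¹' {ε} = Set.pi (Finset.range n : Set ℕ)
        fun k => if h : k < n then {ε ⟨k, h⟩} else univ := by
      ext ω
      simp only [mem_preimage, mem_singleton_iff, Set.mem_pi, Finset.coe_range, mem_Iio]
      constructor
      · rintro rfl k hk
        simp [hk, π]
      · intro h
        funext k
        have := h k k.2
        simpa [π] using this
    rw [measureReal_def, Measure.map_apply hπ (measurableSet_singleton ε), hset,
      Measure.infinitePi_pi _ fun k _ => MeasurableSet.of_discrete, Finset.prod_range]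
    simp [coinMeasure_singleton]
  have h1 : ∫ x, F (fun k => θ x k) ∂unitMeasure = ∫ ω, F (π ω) ∂(unitMeasure.map θ) :=
    (integral_map hθ.aemeasurable (hF.comp hπ).aestronglyMeasurable).symm
  have h2 : ∫ ω, F (π ω) ∂(Measure.infinitePi fun _ : ℕ => coinMeasure) = ∫ ε, F ε ∂ν :=
    (integral_map hπ.aemeasurable hF.aestronglyMeasurable).symm
  rw [h1, hmap, h2, integral_fintype (Integrable.of_finite)]
  simp only [hν, smul_eq_mul, ← Finset.mul_sum]
  rfl

/-- A sequence in `L₁(0,1)` distributed as independent random signs. -/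
theorem exists_rademacher : ∃ ρ : ℕ → L1, ∀ (n : ℕ) (b : ℕ → ℝ),
    ‖∑ k ∈ Finset.range n, b k • ρ k‖ = signAvg n (fun ε => |∑ k : Fin n, b k * sgn (ε k)|) := by
  obtain ⟨θ, hθ, hmap⟩ := exists_coins
  have hm : ∀ k, Measurable fun x => sgn (θ x k) := fun k =>
    (measurable_of_finite sgn).comp ((measurable_pi_apply k).comp hθ)
  have hint : ∀ k, Integrable (fun x => sgn (θ x k)) unitMeasure := fun k =>
    Integrable.of_bound (hm k).aestronglyMeasurable 1
      (Eventually.of_forall fun x => (abs_sgn _).le)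
  refine ⟨fun k => (hint k).toL1 _, fun n b => ?_⟩
  rw [L1.norm_eq_integral_norm, ← integral_coins hθ hmap]
  refine integral_congr_ae ?_
  have h1 := Lp.coeFn_fun_finsetSum (Finset.range n) fun k => b k • (hint k).toL1 _
  have h2 : ∀ᵐ x ∂unitMeasure, ∀ k, (b k • (hint k).toL1 _ : L1) x = b k * (hint k).toL1 _ x :=
    ae_all_iff.2 fun k => Lp.coeFn_smul _ _
  have h3 : ∀ᵐ x ∂unitMeasure, ∀ k, (hint k).toL1 _ x = sgn (θ x k) :=
    ae_all_iff.2 fun k => (hint k).coeFn_toL1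
  filter_upwards [h1, h2, h3] with x hx1 hx2 hx3
  rw [hx1, Finset.sum_range, Real.norm_eq_abs]
  simp only [hx2, hx3]

/-- The first moment is at most the root of the second, because a variance is nonnegative;
orthogonality of the signs computes the second moment. -/
theorem signAvg_abs_sum_le {n : ℕ} (b : Fin n → ℝ) :
    signAvg n (fun ε => |∑ k, b k * sgn (ε k)|) ≤ √(∑ k, b k ^ 2) := by
  refine Real.le_sqrt_of_sq_le ?_
  set S : (Fin n → Bool) → ℝ := fun ε => |∑ k, b k * sgn (ε k)| with hS
  set m := signAvg n S
  have h0 : 0 ≤ signAvg n (fun ε => (S ε - m) ^ 2) := by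
    rw [← signAvg_const (n := n) 0]
    exact signAvg_mono fun ε => sq_nonneg _
  have h1 : ∀ ε, (S ε - m) ^ 2 = S ε ^ 2 + ((-2 * m) * S ε + m ^ 2) := fun ε => by ring
  have h2 : signAvg n (fun ε => S ε ^ 2) = ∑ k, b k ^ 2 := by
    simp only [hS, sq_abs]
    exact signAvg_sq_sum b
  simp only [h1, signAvg_add, signAvg_const_mul, signAvg_const, h2] at h0
  change 0 ≤ _ + (-2 * m * m + m ^ 2) at h0
  linarith

/-- The exponential Khintchine bound is not homogeneous; rescaling b to have ℓ₂ norm 1 turns its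
factor into the constant e. -/
theorem sqrt_sum_sq_le_signAvg {n : ℕ} (b : Fin n → ℝ) :
    √(∑ k, b k ^ 2) ≤ Real.exp 1 * signAvg n (fun ε => |∑ k, b k * sgn (ε k)|) := by
  set A := ∑ k, b k ^ 2 with hA
  have hA0 : 0 ≤ A := Finset.sum_nonneg fun _ _ => sq_nonneg _
  rcases hA0.eq_or_lt with h0 | h0
  · rw [← h0, Real.sqrt_zero]
    have : 0 ≤ signAvg n (fun ε => |∑ k, b k * sgn (ε k)|) := by
      rw [← signAvg_const (n := n) 0]
      exact signAvg_mono fun ε => abs_nonneg _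
    positivity
  have hs := Real.sqrt_pos.2 h0
  have h1 : ∑ k, ((√A)⁻¹ * b k) ^ 2 = 1 := by
    simp only [mul_pow, ← Finset.mul_sum, ← hA, inv_pow, Real.sq_sqrt hA0]
    exact inv_mul_cancel₀ h0.ne'
  have h2 := sum_sq_le_exp_mul_signAvg (fun k => (√A)⁻¹ * b k)
  simp only [h1, mul_assoc, ← Finset.mul_sum, abs_mul _ (∑ k, b k * _), signAvg_const_mul,
    abs_of_pos (inv_pos.2 hs)] at h2
  calc √A = √A * 1 := (mul_one _).symm
    _ ≤ √A * (Real.exp 1 * ((√A)⁻¹ * signAvg n (fun ε => |∑ k, b k * sgn (ε k)|))) := by gcongr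
    _ = _ := by
      field_simp

/-- `ℓ₂` embeds isomorphically into `L₁(0,1)`. -/
theorem exists_embedding_L1 : ∃ j : ell2 →L[ℝ] L1, ∀ a, ‖a‖ ≤ Real.exp 1 * ‖j a‖ := by
  obtain ⟨ρ, hρ⟩ := exists_rademacher
  have hupper : ∀ (b : ℕ → ℝ) (s : Finset ℕ), ‖∑ k ∈ s, b k • ρ k‖ ≤ √(∑ k ∈ s, b k ^ 2) := by
    intro b s
    obtain ⟨n, hn⟩ := s.exists_nat_subset_range
    have h1 : ∑ k ∈ s, b k • ρ k = ∑ k ∈ Finset.range n, (if k ∈ s then b k else 0) • ρ k := by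
      simp only [ite_smul, zero_smul, Finset.sum_ite_mem, Finset.inter_eq_right.2 hn]
    have h2 : ∑ k ∈ s, b k ^ 2 = ∑ k ∈ Finset.range n, (if k ∈ s then b k else 0) ^ 2 := by
      simp only [ite_pow, zero_pow two_ne_zero, Finset.sum_ite_mem, Finset.inter_eq_right.2 hn]
    rw [h1, h2, hρ, Finset.sum_range]
    exact signAvg_abs_sum_le _
  have hlower : ∀ (b : ℕ → ℝ) (n : ℕ), √(∑ k ∈ Finset.range n, b k ^ 2) ≤
      Real.exp 1 * ‖∑ k ∈ Finset.range n, b k • ρ k‖ := fun b n => by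
    rw [hρ, Finset.sum_range]
    exact sqrt_sum_sq_le_signAvg _
  have hsq : ∀ a : ell2, Summable fun k => a k ^ 2 := fun a => by
    have := (lp.memℓp a).summable (by norm_num)
    simpa using this
  have hsum : ∀ a : ell2, Summable fun k => a k • ρ k := fun a => by
    rw [summable_iff_vanishing_norm]
    intro ε hε
    obtain ⟨s, hs⟩ := summable_iff_vanishing_norm.1 (hsq a) (ε ^ 2) (by positivity)
    -- The upper Khintchine estimate turns the Cauchy condition for the squares into one for the
    -- series in L₁.
    refine ⟨s, fun t ht => (hupper _ t).trans_lt ?_⟩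
    rw [Real.sqrt_lt' hε]
    exact (le_abs_self _).trans_lt (hs t ht)
  have hlim : ∀ a : ell2, Tendsto (fun n => √(∑ k ∈ Finset.range n, a k ^ 2)) atTop (𝓝 ‖a‖) :=
    fun a => by
      have h := (Real.continuous_sqrt.tendsto _).comp (hsq a).hasSum.tendsto_sum_nat
      rwa [← norm_sq_eq_tsum, Real.sqrt_sq (norm_nonneg a)] at h
  have hlim' : ∀ a : ell2, Tendsto (fun n => ‖∑ k ∈ Finset.range n, a k • ρ k‖) atTop
      (𝓝 ‖∑' k, a k • ρ k‖) := fun a => (hsum a).hasSum.tendsto_sum_nat.norm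
  refine ⟨LinearMap.mkContinuous
    { toFun := fun a => ∑' k, a k • ρ k
      map_add' := fun a b => ?_
      map_smul' := fun c a => ?_ } 1 fun a => ?_, fun a => ?_⟩
  · rw [← (hsum a).tsum_add (hsum b)]
    simp [add_smul]
  · rw [RingHom.id_apply, ← (hsum a).tsum_const_smul]
    simp [mul_smul]
  · rw [one_mul]
    exact le_of_tendsto_of_tendsto' (hlim' a) (hlim a) fun n => hupper a _
  · exact le_of_tendsto_of_tendsto' (hlim a) ((hlim' a).const_mul _) fun n => hlower a n

/-- An injective operator with closed range and the quotient map by that range form a short exact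
sequence. -/
theorem isShortExact_mkQL {Y E : Type u} [NormedAddCommGroup Y] [NormedSpace ℝ Y]
    [NormedAddCommGroup E] [NormedSpace ℝ E] (j : Y →L[ℝ] E) (hj : Function.Injective j)
    [IsClosed (j.range : Set E)] : IsShortExact j j.range.mkQL :=
  ⟨hj, fun _ => Submodule.Quotient.mk_eq_zero _, Submodule.mkQ_surjective _⟩

theorem exists_isShortExact_L1 :
    ∃ (Z : Type) (_ : NormedAddCommGroup Z) (_ : NormedSpace ℝ Z) (_ : CompleteSpace Z)
      (j : ell2 →L[ℝ] L1) (p : L1 →L[ℝ] Z), IsShortExact j p := by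
  obtain ⟨j, hj⟩ := exists_embedding_L1
  have ha : AntilipschitzWith (Real.exp 1).toNNReal j :=
    AddMonoidHomClass.antilipschitz_of_bound j fun a => by
      rw [Real.coe_toNNReal _ (Real.exp_pos 1).le]
      exact hj a
  have hc : IsClosed (j.range : Set L1) := ha.isClosed_range j.uniformContinuous
  exact ⟨L1 ⧸ j.range, inferInstance, inferInstance, inferInstance, j, j.range.mkQL,
    isShortExact_mkQL j ha.injective⟩

end Rademacher

end BanachExt

/-! ### The nonzero elements of Ext² -/

theorem mainTheorem5 :
    -- `Ext²(·, ℓ₂) ≠ 0` and `Ext²(ℓ₂, ·) ≠ 0`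
    (∃ (Z : Type) (_ : NormedAddCommGroup Z) (_ : NormedSpace ℝ Z) (_ : CompleteSpace Z),
      ¬ BanachExt.Ext2.Vanishes Z BanachExt.ell2) ∧
    (∃ (Z : Type) (_ : NormedAddCommGroup Z) (_ : NormedSpace ℝ Z) (_ : CompleteSpace Z),
      ¬ BanachExt.Ext2.Vanishes BanachExt.ell2 Z) ∧
    -- the building blocks exist: a nontrivial `0 → ℓ₂ → X → ℓ₂ → 0`,
    -- some `0 → ℓ₂ → L₁(0,1) → Z → 0`, and some `0 → K → ℓ_∞ → ℓ₂ → 0`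
    (∃ F : BanachExt.Extension BanachExt.ell2 BanachExt.ell2, ¬ F.Splits) ∧
    (∃ (Z : Type) (_ : NormedAddCommGroup Z) (_ : NormedSpace ℝ Z) (_ : CompleteSpace Z)
      (j : BanachExt.ell2 →L[ℝ] BanachExt.L1) (p : BanachExt.L1 →L[ℝ] Z),
      BanachExt.IsShortExact j p) ∧
    (∃ (K : Type) (_ : NormedAddCommGroup K) (_ : NormedSpace ℝ K) (_ : CompleteSpace K)
      (k : K →L[ℝ] BanachExt.ellInfty) (Q : BanachExt.ellInfty →L[ℝ] BanachExt.ell2),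
      BanachExt.IsShortExact k Q) ∧
    -- `0 → ℓ₂ → X → L₁(0,1) → Z → 0` is a nonzero element of `Ext²(Z, ℓ₂)`
    (∀ F : BanachExt.Extension BanachExt.ell2 BanachExt.ell2, ¬ F.Splits →
      ∀ (Z : Type) [NormedAddCommGroup Z] [NormedSpace ℝ Z] [CompleteSpace Z]
        (j : BanachExt.ell2 →L[ℝ] BanachExt.L1) (p : BanachExt.L1 →L[ℝ] Z)
        (h : BanachExt.IsShortExact j p),
        ¬ (BanachExt.Ext2.mk F
          { space := BanachExt.L1, i := j, q := p, isShortExact := h }).IsZero) ∧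
    -- `0 → K → ℓ_∞ → X → ℓ₂ → 0` is a nonzero element of `Ext²(ℓ₂, K)`
    (∀ F : BanachExt.Extension BanachExt.ell2 BanachExt.ell2, ¬ F.Splits →
      ∀ (K : Type) [NormedAddCommGroup K] [NormedSpace ℝ K] [CompleteSpace K]
        (k : K →L[ℝ] BanachExt.ellInfty) (Q : BanachExt.ellInfty →L[ℝ] BanachExt.ell2)
        (h : BanachExt.IsShortExact k Q),
        ¬ (BanachExt.Ext2.mk
          { space := BanachExt.ellInfty, i := k, q := Q, isShortExact := h } F).IsZero) := by
  obtain ⟨F, hF⟩ := BanachExt.exists_not_splits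
  obtain ⟨Z, _, _, _, j, p, hjp⟩ := BanachExt.exists_isShortExact_L1
  obtain ⟨Q, hQ⟩ := BanachExt.exists_surjection_ellInfty
  have hQe := BanachExt.isShortExact_subtypeL_ker Q hQ
  refine ⟨⟨Z, inferInstance, inferInstance, inferInstance, fun h => hF ?_⟩,
    ⟨Q.ker, inferInstance, inferInstance, inferInstance, fun h => hF ?_⟩, ⟨F, hF⟩,
    ⟨Z, inferInstance, inferInstance, inferInstance, j, p, hjp⟩,
    ⟨Q.ker, inferInstance, inferInstance, inferInstance, _, Q, hQe⟩, ?_, ?_⟩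
  · exact (h (BanachExt.Ext2.mk F ⟨BanachExt.L1, j, p, hjp⟩)).splits_left BanachExt.splits_of_L1
  · exact (h (BanachExt.Ext2.mk ⟨BanachExt.ellInfty, _, Q, hQe⟩ F)).splits_right
      BanachExt.splits_of_ellInfty
  · intro F hF Z _ _ _ j p h hz
    exact hF (hz.splits_left BanachExt.splits_of_L1)
  · intro F hF K _ _ _ k Q h hz
    exact hF (hz.splits_right BanachExt.splits_of_ellInfty)
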